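/- A Krein space is a complex vector space $\mathcal H$ with a Hermitian sesquilinear form $[\cdot,\cdot]$ that admits a fundamental decomposition $\mathcal H=\mathcal H_+[\dotplus]\mathcal H_-$, i.e. a $[\cdot,\cdot]$-orthogonal direct sum such that $(\mathcal H_+,[\cdot,\cdot])$ and $(\mathcal H_-,-[\cdot,\cdot])$ are Hilbert spaces. Its signature operator is $J=P_+-P_-$, where $P_\pm$ is the projection onto $\mathcal H_\pm$ along $\mathcal H_\mp$, and $\langle x,y\rangle=[Jx,y]$ is the associated Hilbert space inner product. Boundedness of operators is meant in the associated Hilbert spaces (all of whose norms are equivalent), $T^\#$ denotes the adjoint with respect to the indefinite metrics, and $R(T)$, $N(T)$ denote range and nullspace. *Hilbert space notions.* Let $B$ be a bounded selfadjoint operator on a Hilbert space, $\mathcal S$ a closed subspace, and $B=\begin{pmatrix}a&b\\ b^*&c\end{pmatrix}$ with respect to $\mathcal S\oplus\mathcal S^\perp$. $B$ is $\mathcal S$-weakly complementable if $R(b)\subseteq R(|a|^{1/2})$. In this case its Schur complement to $\mathcal S$ is $B_{/\mathcal S}=\begin{pmatrix}0&0\\0&c-f^*uf\end{pmatrix}$,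 where $f$ is the reduced solution of $b=|a|^{1/2}x$ (i.e. $b=|a|^{1/2}f$, $N(f)=N(b)$, $R(f)\subseteq\overline{R(|a|^{1/2})}$) and $a=u|a|$, $N(u)=N(a)$, is the polar decomposition of $a$. *Krein space notions.* Let $W=W^\#$ be a bounded operator on the Krein space $\mathcal H$, and $\mathcal S$ a closed subspace. $W$ is $\mathcal S$-weakly complementable if, for some signature operator $J$, $JW$ is $\mathcal S$-weakly complementable in $(\mathcal H,\langle\cdot,\cdot\rangle)$. The Schur complement of $W$ to $\mathcal S$ corresponding to $J$ is $W^J_{/[\mathcal S]}=J\,(JW)_{/\mathcal S}$. A polar factorization of $W$ is a factorization $W=DD^\#$ obtained as follows: choose a signature operator $J$, let $JW=U|JW|$ be the polar decomposition of $JW$ in the Hilbert space associated with $J$, let $\mathcal K=\overline{R(|JW|)}$, which is a Krein space with the metric $[k,k']_{\mathcal K}=\langle Uk,k'\rangle$, and let $D:\mathcal K\to\mathcal H$, $Dk=J|JW|^{1/2}k$. A subspace $\mathcal S$ is regular if $\mathcal H=\mathcal S[\dotplus]\mathcal S^{[\perp]}$, where $\mathcal S^{[\perp]}$ is the orthogonal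 companion of $\mathcal S$ with respect to $[\cdot,\cdot]$; such an $\mathcal S$ is closed, and both $\mathcal S$ and $\mathcal S^{[\perp]}$ are Krein spaces in the metric of $\mathcal H$. **Theorem.** Let $\mathcal H$ be a Krein space, $W=W^\#$ a bounded operator on $\mathcal H$, $\mathcal S$ a regular subspace of $\mathcal H$, and $$W=\begin{pmatrix}w_{11}&w_{12}\\ w_{12}^\#&w_{22}\end{pmatrix}$$ with respect to $\mathcal H=\mathcal S[\dotplus]\mathcal S^{[\perp]}$. Let $w_{11}=dd^\#$, $d:\mathcal K\to\mathcal S$, be any polar factorization of $w_{11}$ (in the Krein space $\mathcal S$). Then $W$ is $\mathcal S$-weakly complementable if and only if $R(w_{12})\subseteq R(d)$. In this case the equation $w_{12}=dx$ has exactly one solution $y:\mathcal S^{[\perp]}\to\mathcal K$, the operator $y$ is bounded, and for every signature operator $J$ of $\mathcal H$ the Schur complement $W^J_{/[\mathcal S]}$ exists and $$W_{/[\mathcal S]}=W^J_{/[\mathcal S]}=\begin{pmatrix}0&0\\0&w_{22}-y^\#y\end{pmatrix}$$ with respect to $\mathcal S[\dotplus]\mathcal S^{[\perp]}$. -/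

import Mathlib

open scoped ComplexConjugate

noncomputable section

/-! ## Hilbert spaces: weak complementability and Schur complement -/

namespace HilbertSchur

variable {E F G : Type*} [NormedAddCommGroup E] [InnerProductSpace ℂ E] [CompleteSpace E]
  [NormedAddCommGroup F] [InnerProductSpace ℂ F] [CompleteSpace F]
  [NormedAddCommGroup G] [InnerProductSpace ℂ G] [CompleteSpace G]

/-- `|a|^{1/2}`, where `|a| = (a* a)^{1/2}` is the modulus of `a`. -/
def sqrtAbs (a : E →L[ℂ] E) : E →L[ℂ] E := CFC.sqrt (CFC.abs a)

/-- `u` is the partial isometry of the polar decomposition `a = u |a|`, `N(u) = N(a)`. -/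
structure IsPolarPart (a u : E →L[ℂ] E) : Prop where
  isometry_on : ∀ x ∈ (LinearMap.ker (u : E →ₗ[ℂ] E))ᗮ, ‖u x‖ = ‖x‖
  ker_eq : LinearMap.ker (u : E →ₗ[ℂ] E) = LinearMap.ker (a : E →ₗ[ℂ] E)
  eq_mul : a = u ∘L CFC.abs a

/-- `X` is the reduced solution of `Z = Y X`:
`Z = Y X`, `N(X) = N(Z)` and `R(X) ⊆ closure R(Y*)`. -/
structure IsReducedSolution (Z : F →L[ℂ] G) (Y : E →L[ℂ] G) (X : F →L[ℂ] E) : Prop where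
  eq_comp : Z = Y ∘L X
  ker_eq : LinearMap.ker (X : F →ₗ[ℂ] E) = LinearMap.ker (Z : F →ₗ[ℂ] G)
  range_le : LinearMap.range (X : F →ₗ[ℂ] E) ≤
    (LinearMap.range (ContinuousLinearMap.adjoint Y : G →ₗ[ℂ] E)).topologicalClosure

variable (B : E →L[ℂ] E) (S : Submodule ℂ E) [CompleteSpace S]

/-- The entry `a` of `B` with respect to `S ⊕ Sᗮ`. -/
def blockA : S →L[ℂ] S := S.orthogonalProjectionOnto ∘L B ∘L S.subtypeL

/-- The entry `b` of `B` with respect to `S ⊕ Sᗮ`. -/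
def blockB : Sᗮ →L[ℂ] S := S.orthogonalProjectionOnto ∘L B ∘L Sᗮ.subtypeL

/-- The entry `c` of `B` with respect to `S ⊕ Sᗮ`. -/
def blockC : Sᗮ →L[ℂ] Sᗮ := Sᗮ.orthogonalProjectionOnto ∘L B ∘L Sᗮ.subtypeL

/-- `B` is `S`-weakly complementable: `R(b) ⊆ R(|a|^{1/2})`. -/
def IsWeaklyComplementable : Prop :=
  LinearMap.range (blockB B S : Sᗮ →ₗ[ℂ] S) ≤
    LinearMap.range (sqrtAbs (blockA B S) : S →ₗ[ℂ] S)

/-- `T` is the Schur complement of `B` to `S`: `T = diag(0, c - f* u f)`, where `f` is the reduced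
solution of `b = |a|^{1/2} x` and `a = u |a|` is the polar decomposition of `a`. -/
def IsSchurComplement (T : E →L[ℂ] E) : Prop :=
  ∃ (f : Sᗮ →L[ℂ] S) (u : S →L[ℂ] S),
    IsReducedSolution (blockB B S) (sqrtAbs (blockA B S)) f ∧
    IsPolarPart (blockA B S) u ∧
    T = Sᗮ.subtypeL ∘L (blockC B S - ContinuousLinearMap.adjoint f ∘L u ∘L f) ∘L
      Sᗮ.orthogonalProjectionOnto

end HilbertSchur

/-! ## Indefinite metrics and Krein spaces -/

/-- An indefinite metric: a sesquilinear Hermitian form. -/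
structure IndefiniteMetric (H : Type*) [AddCommGroup H] [Module ℂ H] where
  form : H →ₗ⋆[ℂ] H →ₗ[ℂ] ℂ
  symm : form.IsSymm

namespace IndefiniteMetric

variable {H H' : Type*} [AddCommGroup H] [Module ℂ H] [AddCommGroup H'] [Module ℂ H']

/-- The indefinite metric induced on a subspace. -/
def restrict (κ : IndefiniteMetric H) (S : Submodule ℂ H) : IndefiniteMetric S where
  form := κ.form.domRestrict₁₂ S S
  symm := κ.symm.domRestrict S

/-- The metric `-[ , ]`. -/
def neg (κ : IndefiniteMetric H) : IndefiniteMetric H where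
  form := -κ.form
  symm := ⟨fun x y => by simp [← κ.symm.eq x y]⟩

/-- Every nonzero vector is positive. -/
def IsPositiveDefinite (κ : IndefiniteMetric H) : Prop :=
  ∀ x, x ≠ 0 → 0 < (κ.form x x).re

/-- The inner product `⟨x, y⟩ = [x, y]` of a positive definite metric. -/
@[reducible]
def core (κ : IndefiniteMetric H) (h : κ.IsPositiveDefinite) : InnerProductSpace.Core ℂ H where
  inner x y := κ.form x y
  conj_inner_symm x y := κ.symm.eq _ _
  re_inner_nonneg x := by
    by_cases hx : x = 0
    · simp [hx]
    · exact (h _ hx).le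
  add_left x y z := by simp
  smul_left x y r := by simp
  definite x hx := by
    by_contra hne
    have := h x hne
    rw [hx] at this
    simp at this

/-- `H` with a positive definite metric as its inner product. -/
def InnerSpace (κ : IndefiniteMetric H) (_ : κ.IsPositiveDefinite) : Type _ := H

section InnerSpace

variable {κ : IndefiniteMetric H} {h : κ.IsPositiveDefinite}

instance : NormedAddCommGroup (κ.InnerSpace h) :=
  @InnerProductSpace.Core.toNormedAddCommGroup ℂ H _ _ _ (core κ h)

instance : InnerProductSpace ℂ (κ.InnerSpace h) :=
  @InnerProductSpace.ofCore ℂ H _ _ _ (core κ h).toCore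

instance : Inner ℂ (κ.InnerSpace h) := InnerProductSpace.toInner

variable (κ h) in
/-- The identity map of `H`. -/
def toInnerSpace : H ≃ₗ[ℂ] κ.InnerSpace h where
  toFun x := x
  invFun x := x
  map_add' _ _ := rfl
  map_smul' _ _ := rfl
  left_inv _ := rfl
  right_inv _ := rfl

theorem inner_def (x y : κ.InnerSpace h) :
    inner ℂ x y = κ.form ((κ.toInnerSpace h).symm x) ((κ.toInnerSpace h).symm y) := rfl

theorem norm_sq_def (x : H) : ‖κ.toInnerSpace h x‖ ^ 2 = (κ.form x x).re := by
  rw [@norm_sq_eq_re_inner ℂ, inner_def]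
  simp

end InnerSpace

/-- `(H, [ , ])` is a Hilbert space. -/
def IsHilbert (κ : IndefiniteMetric H) : Prop :=
  ∃ h : κ.IsPositiveDefinite, CompleteSpace (κ.InnerSpace h)

/-- A fundamental decomposition `H = H₊ [∔] H₋`, with `(H₊, [ , ])` and `(H₋, -[ , ])` Hilbert
spaces. -/
structure FundamentalDecomposition (κ : IndefiniteMetric H) where
  pos : Submodule ℂ H
  neg : Submodule ℂ H
  isCompl : IsCompl pos neg
  orthogonal : ∀ x ∈ pos, ∀ y ∈ neg, κ.form x y = 0
  isHilbert_pos : (κ.restrict pos).IsHilbert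
  isHilbert_neg : (κ.restrict neg).neg.IsHilbert

/-- `(H, [ , ])` is a Krein space. -/
def IsKrein (κ : IndefiniteMetric H) : Prop := Nonempty κ.FundamentalDecomposition

namespace FundamentalDecomposition

variable {κ : IndefiniteMetric H} (D : κ.FundamentalDecomposition)

/-- The projection onto `H₊` along `H₋`. -/
def projPos : H →ₗ[ℂ] H := D.pos.projection D.neg D.isCompl

/-- The projection onto `H₋` along `H₊`. -/
def projNeg : H →ₗ[ℂ] H := D.neg.projection D.pos D.isCompl.symm

/-- The signature operator `J = P₊ - P₋`. -/
def signature : H →ₗ[ℂ] H := D.projPos - D.projNeg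

theorem projPos_add_projNeg (x : H) : D.projPos x + D.projNeg x = x :=
  Submodule.projection_add_projection_eq_self D.isCompl x

theorem projPos_mem (x : H) : D.projPos x ∈ D.pos := Submodule.projection_apply_mem _ _

theorem projNeg_mem (x : H) : D.projNeg x ∈ D.neg := Submodule.projection_apply_mem _ _

theorem orthogonal' {x y : H} (hx : x ∈ D.neg) (hy : y ∈ D.pos) : κ.form x y = 0 := by
  rw [← κ.symm.eq y x, D.orthogonal y hy x hx, map_zero]

theorem form_signature (x y : H) : κ.form (D.signature x) y =
    κ.form (D.projPos x) (D.projPos y) - κ.form (D.projNeg x) (D.projNeg y) := by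
  conv_lhs => rw [← D.projPos_add_projNeg y]
  simp [signature, D.orthogonal _ (D.projPos_mem x) _ (D.projNeg_mem y),
    D.orthogonal' (D.projNeg_mem x) (D.projPos_mem y)]

/-- The inner product `⟨x, y⟩ = [Jx, y]`. -/
def innerMetric : IndefiniteMetric H where
  form := κ.form.comp D.signature
  symm := ⟨fun x y => by
    simp only [LinearMap.comp_apply, form_signature, map_sub, κ.symm.eq]⟩

theorem innerMetric_form (x y : H) : D.innerMetric.form x y = κ.form (D.signature x) y := rfl

theorem innerMetric_posDef : D.innerMetric.IsPositiveDefinite := by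
  intro x hx
  obtain ⟨hp, -⟩ := D.isHilbert_pos
  obtain ⟨hn, -⟩ := D.isHilbert_neg
  rw [innerMetric_form, form_signature, Complex.sub_re]
  have h1 : D.projPos x ≠ 0 → 0 < (κ.form (D.projPos x) (D.projPos x)).re := fun h =>
    hp ⟨_, D.projPos_mem x⟩ (by simpa [Subtype.ext_iff] using h)
  have h2 : D.projNeg x ≠ 0 → 0 < -(κ.form (D.projNeg x) (D.projNeg x)).re := fun h =>
    hn ⟨_, D.projNeg_mem x⟩ (by simpa [Subtype.ext_iff] using h)
  have h3 := D.projPos_add_projNeg x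
  by_cases hx1 : D.projPos x = 0
  · by_cases hx2 : D.projNeg x = 0
    · exact absurd (by rw [← h3, hx1, hx2, add_zero]) hx
    · have := h2 hx2
      simp only [hx1, map_zero, Complex.zero_re]
      linarith
  · have := h1 hx1
    by_cases hx2 : D.projNeg x = 0
    · simp only [hx2, map_zero, Complex.zero_re]
      linarith
    · have := h2 hx2
      linarith

/-- The Hilbert space `(H, ⟨ , ⟩)`, `⟨x, y⟩ = [Jx, y]`, associated with a fundamental
decomposition. -/
abbrev Hilbert : Type _ := D.innerMetric.InnerSpace D.innerMetric_posDef

/-- The identity map of `H`, into the associated Hilbert space. -/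
abbrev toHilbert : H ≃ₗ[ℂ] D.Hilbert := D.innerMetric.toInnerSpace D.innerMetric_posDef

theorem signature_signature (x : H) : D.signature (D.signature x) = x := by
  have h1 (z : H) (hz : z ∈ D.pos) : D.signature z = z := by
    simp [signature, projPos, projNeg, Submodule.projection_apply_of_mem_left _ hz,
      (Submodule.projection_apply_eq_zero_iff D.isCompl.symm).2 hz]
  have h2 (z : H) (hz : z ∈ D.neg) : D.signature z = -z := by
    simp [signature, projPos, projNeg, Submodule.projection_apply_of_mem_left _ hz,
      (Submodule.projection_apply_eq_zero_iff D.isCompl).2 hz]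
  have h3 : D.signature x = D.projPos x - D.projNeg x := rfl
  rw [h3, map_sub, h1 _ (D.projPos_mem x), h2 _ (D.projNeg_mem x), sub_neg_eq_add,
    D.projPos_add_projNeg]

theorem form_signature_right (x y : H) :
    κ.form x (D.signature y) = κ.form (D.signature x) y := by
  rw [← κ.symm.eq, ← innerMetric_form, D.innerMetric.symm.eq, innerMetric_form]

theorem inner_toHilbert (x y : H) :
    inner ℂ (D.toHilbert x) (D.toHilbert y) = κ.form (D.signature x) y := by
  rw [inner_def, innerMetric_form, LinearEquiv.symm_apply_apply, LinearEquiv.symm_apply_apply]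

theorem norm_sq_toHilbert (x : H) : ‖D.toHilbert x‖ ^ 2 =
    (κ.form (D.projPos x) (D.projPos x)).re - (κ.form (D.projNeg x) (D.projNeg x)).re := by
  rw [norm_sq_def, innerMetric_form, form_signature, Complex.sub_re]

instance : CompleteSpace D.Hilbert := by
  obtain ⟨hp, hpc⟩ := D.isHilbert_pos
  obtain ⟨hn, hnc⟩ := D.isHilbert_neg
  let p : H → (κ.restrict D.pos).InnerSpace hp :=
    fun x => (κ.restrict D.pos).toInnerSpace hp ⟨D.projPos x, D.projPos_mem x⟩
  let n : H → (κ.restrict D.neg).neg.InnerSpace hn :=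
    fun x => (κ.restrict D.neg).neg.toInnerSpace hn ⟨D.projNeg x, D.projNeg_mem x⟩
  have hnorm (x : H) : ‖D.toHilbert x‖ ^ 2 = ‖p x‖ ^ 2 + ‖n x‖ ^ 2 := by
    rw [norm_sq_toHilbert, norm_sq_def, norm_sq_def]
    rfl
  have hpsub (x y : H) : p x - p y = p (x - y) := by
    simp only [p, ← map_sub]
    congr 1
    exact Subtype.ext (map_sub D.projPos x y).symm
  have hnsub (x y : H) : n x - n y = n (x - y) := by
    simp only [n, ← map_sub]
    congr 1
    exact Subtype.ext (map_sub D.projNeg x y).symm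
  refine Metric.complete_of_cauchySeq_tendsto fun v hv => ?_
  obtain ⟨w, rfl⟩ : ∃ w : ℕ → H, v = fun k => D.toHilbert (w k) :=
    ⟨fun k => D.toHilbert.symm (v k), by simp⟩
  rw [Metric.cauchySeq_iff] at hv
  have hple (x : H) : ‖p x‖ ≤ ‖D.toHilbert x‖ := by
    refine le_of_sq_le_sq ?_ (norm_nonneg _)
    rw [hnorm]
    nlinarith [sq_nonneg ‖n x‖]
  have hnle (x : H) : ‖n x‖ ≤ ‖D.toHilbert x‖ := by
    refine le_of_sq_le_sq ?_ (norm_nonneg _)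
    rw [hnorm]
    nlinarith [sq_nonneg ‖p x‖]
  have hpC : CauchySeq fun k => p (w k) := by
    rw [Metric.cauchySeq_iff]
    intro ε hε
    obtain ⟨N, hN⟩ := hv ε hε
    refine ⟨N, fun k hk l hl => lt_of_le_of_lt ?_ (hN k hk l hl)⟩
    rw [dist_eq_norm, dist_eq_norm, hpsub, ← map_sub]
    exact hple _
  have hnC : CauchySeq fun k => n (w k) := by
    rw [Metric.cauchySeq_iff]
    intro ε hε
    obtain ⟨N, hN⟩ := hv ε hε
    refine ⟨N, fun k hk l hl => lt_of_le_of_lt ?_ (hN k hk l hl)⟩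
    rw [dist_eq_norm, dist_eq_norm, hnsub, ← map_sub]
    exact hnle _
  obtain ⟨a, ha⟩ := cauchySeq_tendsto_of_complete hpC
  obtain ⟨b, hb⟩ := cauchySeq_tendsto_of_complete hnC
  let a' : D.pos := ((κ.restrict D.pos).toInnerSpace hp).symm a
  let b' : D.neg := ((κ.restrict D.neg).neg.toInnerSpace hn).symm b
  have hpa : p (a' + b') = a := by
    have : D.projPos (a' + b') = a' := by
      rw [map_add, projPos, Submodule.projection_apply_left, Submodule.projection_apply_right,
        add_zero]
    simp only [p, this]
    simp [a']
  have hnb : n (a' + b') = b := by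
    have : D.projNeg (a' + b') = b' := by
      rw [map_add, projNeg, Submodule.projection_apply_left, Submodule.projection_apply_right,
        zero_add]
    simp only [n, this]
    simp [b']
  refine ⟨D.toHilbert (a' + b'), ?_⟩
  rw [tendsto_iff_norm_sub_tendsto_zero] at ha hb ⊢
  have key := ((ha.pow 2).add (hb.pow 2)).sqrt
  simp only [ne_eq, OfNat.ofNat_ne_zero, not_false_eq_true, zero_pow, add_zero,
    Real.sqrt_zero] at key
  refine key.congr fun k => ?_
  rw [← hpa, ← hnb, hpsub, hnsub, ← hnorm, Real.sqrt_sq (norm_nonneg _), map_sub]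

end FundamentalDecomposition

/-! ## Operators on Krein spaces -/

/-- `T ∈ L(H, H')`: `T` is bounded in associated Hilbert spaces. -/
def IsBoundedOperator (κ : IndefiniteMetric H) (κ' : IndefiniteMetric H') (T : H →ₗ[ℂ] H') :
    Prop :=
  ∃ (D : κ.FundamentalDecomposition) (D' : κ'.FundamentalDecomposition) (C : ℝ),
    ∀ x, ‖D'.toHilbert (T x)‖ ≤ C * ‖D.toHilbert x‖

/-- `T' = T^#`: `[Tx, y] = [x, T'y]` for all `x`, `y`. -/
def IsAdjoint (κ : IndefiniteMetric H) (κ' : IndefiniteMetric H') (T : H →ₗ[ℂ] H')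
    (T' : H' →ₗ[ℂ] H) : Prop :=
  ∀ x y, κ'.form (T x) y = κ.form x (T' y)

/-- `W ∈ L(H)^{[s]}`: `W` is bounded and `W = W^#`. -/
structure IsSelfadjointOperator (κ : IndefiniteMetric H) (W : H →ₗ[ℂ] H) : Prop where
  bounded : κ.IsBoundedOperator κ W
  adjoint : κ.IsAdjoint κ W W

/-- The orthogonal companion `S^{[⊥]}`. -/
def companion (κ : IndefiniteMetric H) (S : Submodule ℂ H) : Submodule ℂ H :=
  S.orthogonalBilin κ.form

/-- `S` is regular: `H = S [∔] S^{[⊥]}`. In a Krein space, such an `S` is closed. -/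
def IsRegular (κ : IndefiniteMetric H) (S : Submodule ℂ H) : Prop :=
  IsCompl S (κ.companion S)

namespace IsRegular

variable {κ : IndefiniteMetric H} {S : Submodule ℂ H} (hS : κ.IsRegular S)

/-- The projection `H → S` along `S^{[⊥]}`. -/
def proj₁ : H →ₗ[ℂ] S := S.projectionOnto (κ.companion S) hS

/-- The projection `H → S^{[⊥]}` along `S`. -/
def proj₂ : H →ₗ[ℂ] κ.companion S := (κ.companion S).projectionOnto S hS.symm

variable (W : H →ₗ[ℂ] H)

/-- The entry `w₁₁` of `W` with respect to `S [∔] S^{[⊥]}`. -/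
def block₁₁ : S →ₗ[ℂ] S := hS.proj₁ ∘ₗ W ∘ₗ S.subtype

/-- The entry `w₁₂` of `W` with respect to `S [∔] S^{[⊥]}`. -/
def block₁₂ : κ.companion S →ₗ[ℂ] S := hS.proj₁ ∘ₗ W ∘ₗ (κ.companion S).subtype

/-- The entry `w₂₂` of `W` with respect to `S [∔] S^{[⊥]}`. -/
def block₂₂ : κ.companion S →ₗ[ℂ] κ.companion S := hS.proj₂ ∘ₗ W ∘ₗ (κ.companion S).subtype

/-- The operator `diag(0, z)` with respect to `S [∔] S^{[⊥]}`. -/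
def diagZero (z : κ.companion S →ₗ[ℂ] κ.companion S) : H →ₗ[ℂ] H :=
  (κ.companion S).subtype ∘ₗ z ∘ₗ hS.proj₂

end IsRegular

namespace FundamentalDecomposition

variable {κ : IndefiniteMetric H} (D : κ.FundamentalDecomposition)

/-- `B` is the operator `JW` on the Hilbert space associated with `D`. -/
def IsSignatureMul (W : H →ₗ[ℂ] H) (B : D.Hilbert →L[ℂ] D.Hilbert) : Prop :=
  ∀ x : H, B (D.toHilbert x) = D.toHilbert (D.signature (W x))

/-- `S` as a subspace of the Hilbert space associated with `D`. -/
abbrev subspace (S : Submodule ℂ H) : Submodule ℂ D.Hilbert :=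
  S.map (D.toHilbert : H →ₗ[ℂ] D.Hilbert)

/-- `W` is `S`-weakly complementable with respect to the signature operator `J` of `D`: `S` is
closed and `JW` is `S`-weakly complementable in the Hilbert space `(H, ⟨ , ⟩)`. -/
def IsWeaklyComplementable (W : H →ₗ[ℂ] H) (S : Submodule ℂ H) : Prop :=
  ∃ (B : D.Hilbert →L[ℂ] D.Hilbert) (_ : CompleteSpace (D.subspace S)),
    D.IsSignatureMul W B ∧ HilbertSchur.IsWeaklyComplementable B (D.subspace S)

/-- `T` is the Schur complement of `W` to `S` corresponding to the signature operator `J` of `D`: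
`T = J (JW)_{/S}`. -/
def IsSchurComplement (W : H →ₗ[ℂ] H) (S : Submodule ℂ H) (T : H →ₗ[ℂ] H) : Prop :=
  ∃ (B T₀ : D.Hilbert →L[ℂ] D.Hilbert) (_ : CompleteSpace (D.subspace S)),
    D.IsSignatureMul W B ∧ HilbertSchur.IsSchurComplement B (D.subspace S) T₀ ∧
    ∀ x : H, T x = D.signature (D.toHilbert.symm (T₀ (D.toHilbert x)))

end FundamentalDecomposition

/-- `W` is `S`-weakly complementable, with respect to some signature operator. -/
def IsWeaklyComplementable (κ : IndefiniteMetric H) (W : H →ₗ[ℂ] H) (S : Submodule ℂ H) : Prop :=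
  ∃ D : κ.FundamentalDecomposition, D.IsWeaklyComplementable W S

/-- The data that determine a polar factorization `W = D D^#` of a selfadjoint operator `W`:
a signature operator `J`, and the polar decomposition `JW = U |JW|` in the Hilbert space that
belongs to `J`. -/
structure PolarFactorization (κ : IndefiniteMetric H) (W : H →ₗ[ℂ] H) where
  selfadjoint : κ.IsAdjoint κ W W
  decomp : κ.FundamentalDecomposition
  JW : decomp.Hilbert →L[ℂ] decomp.Hilbert
  isSignatureMul : decomp.IsSignatureMul W JW
  U : decomp.Hilbert →L[ℂ] decomp.Hilbert
  isPolarPart : HilbertSchur.IsPolarPart JW U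

namespace PolarFactorization

variable {κ : IndefiniteMetric H} {W : H →ₗ[ℂ] H} (F : κ.PolarFactorization W)

/-- The space `𝒦`, the closure of `R(|JW|)`. -/
def space : Submodule ℂ F.decomp.Hilbert :=
  (LinearMap.range ((CFC.abs F.JW : F.decomp.Hilbert →L[ℂ] F.decomp.Hilbert) :
    F.decomp.Hilbert →ₗ[ℂ] F.decomp.Hilbert)).topologicalClosure

theorem isSelfAdjoint_JW : IsSelfAdjoint F.JW := by
  rw [ContinuousLinearMap.isSelfAdjoint_iff_isSymmetric]
  intro x y
  obtain ⟨x, rfl⟩ := F.decomp.toHilbert.surjective x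
  obtain ⟨y, rfl⟩ := F.decomp.toHilbert.surjective y
  simp only [ContinuousLinearMap.coe_coe]
  rw [F.isSignatureMul x, F.isSignatureMul y, F.decomp.inner_toHilbert, F.decomp.inner_toHilbert,
    F.decomp.signature_signature, F.decomp.form_signature_right, F.decomp.signature_signature]
  exact F.selfadjoint x y

theorem U_abs (x : F.decomp.Hilbert) : F.U (CFC.abs F.JW x) = F.JW x :=
  (DFunLike.congr_fun F.isPolarPart.eq_mul x).symm

theorem inner_U_symm (x y : F.space) :
    inner ℂ (F.U x) (y : F.decomp.Hilbert) = inner ℂ (x : F.decomp.Hilbert) (F.U y) := by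
  have hsa := F.isSelfAdjoint_JW
  have hJ := (ContinuousLinearMap.isSelfAdjoint_iff_isSymmetric.1 hsa)
  have habs := (ContinuousLinearMap.isSelfAdjoint_iff_isSymmetric.1
    (IsSelfAdjoint.of_nonneg (CFC.abs_nonneg F.JW)))
  have hcomm (z : F.decomp.Hilbert) : CFC.abs F.JW (F.JW z) = F.JW (CFC.abs F.JW z) :=
    DFunLike.congr_fun (CFC.commute_abs_self F.JW hsa.isStarNormal).eq z
  have hdense (z w : F.decomp.Hilbert) :
      inner ℂ (F.U (CFC.abs F.JW z)) (CFC.abs F.JW w) =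
        inner ℂ (CFC.abs F.JW z) (F.U (CFC.abs F.JW w)) := by
    rw [F.U_abs, F.U_abs]
    have e1 := habs (F.JW z) w
    have e2 := hJ (CFC.abs F.JW z) w
    simp only [ContinuousLinearMap.coe_coe] at e1 e2
    rw [← e1, ← e2, hcomm]
  have h1 (z : F.decomp.Hilbert) (v : F.decomp.Hilbert) (hv : v ∈ F.space) :
      inner ℂ (F.U (CFC.abs F.JW z)) v = inner ℂ (CFC.abs F.JW z) (F.U v) := by
    refine closure_minimal (t := {v | inner ℂ (F.U (CFC.abs F.JW z)) v =
      inner ℂ (CFC.abs F.JW z) (F.U v)}) ?_ (isClosed_eq (by fun_prop) (by fun_prop)) hv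
    rintro _ ⟨w, rfl⟩
    exact hdense z w
  refine closure_minimal (t := {v | inner ℂ (F.U v) (y : F.decomp.Hilbert) =
      inner ℂ v (F.U y)}) ?_ (isClosed_eq (by fun_prop) (by fun_prop)) x.2
  rintro _ ⟨w, rfl⟩
  exact h1 w y y.2

/-- The indefinite metric `[x, y] = ⟨Ux, y⟩` of `𝒦`, with signature operator `U|_𝒦`. -/
def metric : IndefiniteMetric F.space where
  form := ((innerₛₗ ℂ).comp (F.U : F.decomp.Hilbert →ₗ[ℂ] F.decomp.Hilbert)).domRestrict₁₂
    F.space F.space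
  symm := ⟨fun x y => by
    change conj (inner ℂ (F.U x) (y : F.decomp.Hilbert)) = inner ℂ (F.U y) (x : F.decomp.Hilbert)
    rw [inner_conj_symm, F.inner_U_symm]⟩

/-- The operator `D : 𝒦 → H`, `D k = J |JW|^{1/2} k`. It is injective, and `W = D D^#`: see
`op_injective` and `op_comp_adjoint`. -/
def op : F.space →ₗ[ℂ] H :=
  F.decomp.signature ∘ₗ (F.decomp.toHilbert.symm : F.decomp.Hilbert →ₗ[ℂ] H) ∘ₗ
    (HilbertSchur.sqrtAbs F.JW : F.decomp.Hilbert →ₗ[ℂ] F.decomp.Hilbert) ∘ₗ F.space.subtype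

theorem mem_space_iff (v : F.decomp.Hilbert) : v ∈ F.space ↔
    ∀ z, CFC.abs F.JW z = 0 → inner ℂ z v = 0 := by
  have habs := IsSelfAdjoint.of_nonneg (CFC.abs_nonneg F.JW)
  rw [space, ← Submodule.orthogonal_orthogonal_eq_closure,
    ContinuousLinearMap.orthogonal_range, ← ContinuousLinearMap.star_eq_adjoint, habs.star_eq]
  rfl

theorem ker_facts (z : F.decomp.Hilbert) : (CFC.abs F.JW z = 0 ↔ F.JW z = 0) ∧
    (CFC.abs F.JW z = 0 ↔ HilbertSchur.sqrtAbs F.JW z = 0) := by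
  have hr : HilbertSchur.sqrtAbs F.JW * HilbertSchur.sqrtAbs F.JW = CFC.abs F.JW :=
    CFC.sqrt_mul_sqrt_self _ (CFC.abs_nonneg _)
  have hrz : HilbertSchur.sqrtAbs F.JW (HilbertSchur.sqrtAbs F.JW z) = CFC.abs F.JW z :=
    DFunLike.congr_fun hr z
  have hrs := (ContinuousLinearMap.isSelfAdjoint_iff_isSymmetric.1
    (IsSelfAdjoint.of_nonneg (CFC.sqrt_nonneg (CFC.abs F.JW))))
  have hJs := (ContinuousLinearMap.isSelfAdjoint_iff_isSymmetric.1 F.isSelfAdjoint_JW)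
  have haa : CFC.abs F.JW (CFC.abs F.JW z) = F.JW (F.JW z) := by
    have := DFunLike.congr_fun (CFC.abs_mul_abs F.JW) z
    rwa [F.isSelfAdjoint_JW.star_eq] at this
  refine ⟨⟨fun h => ?_, fun h => ?_⟩, fun h => ?_, fun h => by rw [← hrz, h, map_zero]⟩
  · rw [← F.U_abs, h, map_zero]
  · have habs := (ContinuousLinearMap.isSelfAdjoint_iff_isSymmetric.1
      (IsSelfAdjoint.of_nonneg (CFC.abs_nonneg F.JW)))
    have e := habs z (CFC.abs F.JW z)
    simp only [ContinuousLinearMap.coe_coe] at e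
    rw [haa, h, map_zero, inner_zero_right, inner_self_eq_zero] at e
    exact e
  · have e := hrs z (HilbertSchur.sqrtAbs F.JW z)
    simp only [ContinuousLinearMap.coe_coe] at e
    change inner ℂ (HilbertSchur.sqrtAbs F.JW z) _ = inner ℂ z
      (HilbertSchur.sqrtAbs F.JW (HilbertSchur.sqrtAbs F.JW z)) at e
    rw [hrz, h, inner_zero_right, inner_self_eq_zero] at e
    exact e

/-- `N(D) = {0}`. -/
theorem op_injective : Function.Injective F.op := by
  rw [← LinearMap.ker_eq_bot, LinearMap.ker_eq_bot']
  intro k hk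
  have h1 : HilbertSchur.sqrtAbs F.JW k = 0 := by
    have := congrArg F.decomp.signature hk
    simp only [op, LinearMap.comp_apply, F.decomp.signature_signature, map_zero] at this
    simpa using this
  have h2 := (F.mem_space_iff k).1 k.2 k ((F.ker_facts k).2.2 h1)
  exact Subtype.ext (inner_self_eq_zero.1 h2)

/-- `W = D D^#`. -/
theorem op_comp_adjoint : ∃ d' : H →ₗ[ℂ] F.space, F.metric.IsAdjoint κ F.op d' ∧ F.op ∘ₗ d' = W := by
  set r := HilbertSchur.sqrtAbs F.JW with hrdef
  have hr : r * r = CFC.abs F.JW :=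
    CFC.sqrt_mul_sqrt_self _ (CFC.abs_nonneg _)
  have hrs : ∀ x y, inner ℂ (r x) y = inner ℂ x (r y) :=
    (ContinuousLinearMap.isSelfAdjoint_iff_isSymmetric.1
    (IsSelfAdjoint.of_nonneg (CFC.sqrt_nonneg (CFC.abs F.JW))))
  have hJs : ∀ x y, inner ℂ (F.JW x) y = inner ℂ x (F.JW y) :=
    (ContinuousLinearMap.isSelfAdjoint_iff_isSymmetric.1 F.isSelfAdjoint_JW)
  have hcomm : ∀ z, r (F.JW z) = F.JW (r z) := by
    have := (CFC.commute_abs_self F.JW F.isSelfAdjoint_JW.isStarNormal).cfcₙ_nnreal NNReal.sqrt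
    exact fun z => DFunLike.congr_fun this.eq z
  have hrmem : ∀ z, r z ∈ F.space := fun z => (F.mem_space_iff _).2 fun w hw => by
    rw [← hrs, (F.ker_facts w).2.1 hw, inner_zero_left]
  have hUmem : ∀ v ∈ F.space, F.U v ∈ F.space := by
    intro v hv
    refine closure_minimal (t := {v | F.U v ∈ F.space}) ?_ ?_ hv
    · rintro _ ⟨w, rfl⟩
      change F.U (CFC.abs F.JW w) ∈ F.space
      rw [F.U_abs]
      refine (F.mem_space_iff _).2 fun z hz => ?_
      rw [← hJs, (F.ker_facts z).1.1 hz, inner_zero_left]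
    · exact (Submodule.isClosed_topologicalClosure _).preimage F.U.continuous
  have hiso : ∀ v ∈ F.space, ‖F.U v‖ = ‖v‖ := by
    intro v hv
    refine F.isPolarPart.isometry_on v ?_
    rw [F.isPolarPart.ker_eq]
    intro z hz
    exact (F.mem_space_iff v).1 hv z ((F.ker_facts z).1.2 hz)
  let Ui : F.space →ₗᵢ[ℂ] F.decomp.Hilbert :=
    ⟨(F.U : F.decomp.Hilbert →ₗ[ℂ] F.decomp.Hilbert) ∘ₗ F.space.subtype, fun v => hiso v v.2⟩
  have hUi : ∀ v w : F.space, inner ℂ (F.U v) (F.U w) = inner ℂ (v : F.decomp.Hilbert) w :=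
    fun v w => Ui.inner_map_map v w
  refine ⟨LinearMap.codRestrict F.space ((F.U : F.decomp.Hilbert →ₗ[ℂ] F.decomp.Hilbert) ∘ₗ
    (r : F.decomp.Hilbert →ₗ[ℂ] F.decomp.Hilbert) ∘ₗ (F.decomp.toHilbert : H →ₗ[ℂ] _))
    (fun z => hUmem _ (hrmem _)), ?_, ?_⟩
  · intro k y
    have e := F.decomp.inner_toHilbert (F.decomp.toHilbert.symm (r k)) y
    rw [LinearEquiv.apply_symm_apply] at e
    refine e.symm.trans ?_
    rw [hrs]
    exact (hUi k ⟨r (F.decomp.toHilbert y), hrmem _⟩).symm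
  · have key : ∀ z, r (F.U (r z)) = F.JW z := by
      have hsp : ∀ z ∈ F.space, r (F.U (r z)) = F.JW z := by
        intro z hz
        refine closure_minimal (t := {z | r (F.U (r z)) = F.JW z}) ?_
          (isClosed_eq (by fun_prop) (by fun_prop)) hz
        rintro _ ⟨w, rfl⟩
        have e1 : CFC.abs F.JW w = r (r w) := (DFunLike.congr_fun hr w).symm
        change r (F.U (r (CFC.abs F.JW w))) = F.JW (CFC.abs F.JW w)
        have e2 : r (CFC.abs F.JW w) = CFC.abs F.JW (r w) := by
          rw [e1]; exact DFunLike.congr_fun hr (r w)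
        rw [e2, F.U_abs, hcomm, e1]
      intro z
      have : CompleteSpace F.space :=
        (Submodule.isClosed_topologicalClosure _).completeSpace_coe
      obtain ⟨p, hp, q, hq, rfl⟩ := F.space.exists_add_mem_mem_orthogonal z
      have hq0 : CFC.abs F.JW q = 0 := by
        rw [← inner_self_eq_zero (𝕜 := ℂ)]
        have habs := (ContinuousLinearMap.isSelfAdjoint_iff_isSymmetric.1
          (IsSelfAdjoint.of_nonneg (CFC.abs_nonneg F.JW)))
        have := habs (CFC.abs F.JW q) q
        simp only [ContinuousLinearMap.coe_coe] at this
        rw [← this]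
        exact hq _ (subset_closure ⟨_, rfl⟩)
      rw [map_add, map_add, map_add, map_add, hsp p hp, (F.ker_facts q).2.1 hq0,
        (F.ker_facts q).1.1 hq0, map_zero, map_zero]
    ext x
    change F.decomp.signature (F.decomp.toHilbert.symm (r (F.U (r (F.decomp.toHilbert x))))) = _
    rw [key, F.isSignatureMul, LinearEquiv.symm_apply_apply, F.decomp.signature_signature]

end PolarFactorization

end IndefiniteMetric

end

/-! The proof rests on objects that involve no signature operator: the form [Wx, z] on H and the
functionals [Wx, ·] on S. A signature operator, of H or of S, only selects a Hilbert inner product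
on S, and the identity of S is an isomorphism T between any two of these (`exists_subspace_equiv`).
The operators that represent [Wx, y] on S in two such inner products are therefore congruent: a₁ =
T* a₂ T.

Two invariants of congruence carry the argument. By Löwner–Heinz the forms of |a₁| and T*|a₂|T are
comparable, hence R(|a₁|^{1/2}) = T* R(|a₂|^{1/2}) (`mem_range_sqrtAbs_iff_of_congr`). Moreover ⟨ug,
g'⟩ depends only on the functionals ⟨|a|^{1/2}g, ·⟩ and ⟨|a|^{1/2}g', ·⟩ (`inner_polarPart_congr`).

The Hilbert complement of S differs from S^{[⊥]} in general, so the entries b and w₁₂ cannot be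
compared directly. Whole rows can: a = |a|^{1/2} u |a|^{1/2} and w₁₁ = dd^# already have their
ranges in R(|a|^{1/2}) and R(d), so each range condition may be stated for the full row. If k_x
solves d k = P W x, with P the projection onto S along S^{[⊥]}, then both diag(0, w₂₂ - y^#y) and
the Schur complement for any J have the form [Wx, z] - [k_x, k_z] (`form_diagZero`,
`form_schurComplement`), so they coincide.

The solution y is unique because d is injective, and it is bounded by the closed graph theorem,
since R(d^#) separates the points of 𝒦. -/

noncomputable section

/-! ### Hilbert spaces: domination and factorization. -/

namespace HilbertSchur

variable {E F G : Type*} [NormedAddCommGroup E] [InnerProductSpace ℂ E] [CompleteSpace E]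
  [NormedAddCommGroup F] [InnerProductSpace ℂ F] [CompleteSpace F]
  [NormedAddCommGroup G] [InnerProductSpace ℂ G] [CompleteSpace G]

omit [CompleteSpace E] in
/-- An operator dominated by `B` factors through `B`, by an operator that vanishes on `R(B)ᗮ`. -/
theorem exists_comp_eq_of_norm_le (A : E →L[ℂ] G) (B : E →L[ℂ] F) (C : ℝ)
    (h : ∀ x, ‖A x‖ ≤ C * ‖B x‖) :
    ∃ V : F →L[ℂ] G, (∀ x, V (B x) = A x) ∧
      ∀ y ∈ (LinearMap.range (B : E →ₗ[ℂ] F))ᗮ, V y = 0 := by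
  let K := (LinearMap.range (B : E →ₗ[ℂ] F)).topologicalClosure
  have hKc : IsClosed (K : Set F) := Submodule.isClosed_topologicalClosure _
  have : CompleteSpace K := hKc.completeSpace_coe
  have hK (x : E) : B x ∈ K := Submodule.le_topologicalClosure _ ⟨x, rfl⟩
  let e : E →ₗ[ℂ] K := (B : E →ₗ[ℂ] F).codRestrict K hK
  -- `e` is B with values in the closure of its range; density and the norm bound extend Bx ↦ Ax
  -- continuously to that closure.
  have hd : DenseRange e := by
    intro k
    rw [Topology.IsInducing.subtypeVal.closure_eq_preimage_closure_image]
    have hk : (k : F) ∈ closure (LinearMap.range (B : E →ₗ[ℂ] F) : Set F) := k.2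
    refine closure_mono ?_ hk
    rintro _ ⟨x, rfl⟩
    exact ⟨e x, ⟨x, rfl⟩, rfl⟩
  have he (x : E) : (A : E →ₗ[ℂ] G).extendOfNorm e (e x) = A x :=
    LinearMap.extendOfNorm_eq hd ⟨C, h⟩ x
  refine ⟨(A : E →ₗ[ℂ] G).extendOfNorm e ∘L K.orthogonalProjectionOnto, fun x => ?_,
    fun y hy => ?_⟩
  · have : K.orthogonalProjectionOnto (B x) = e x :=
      Submodule.orthogonalProjectionOnto_mem_subspace_eq_self (e x)
    rw [ContinuousLinearMap.comp_apply, this, he]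
  · have hy' : y ∈ Kᗮ := by
      rwa [Submodule.orthogonal_closure]
    rw [ContinuousLinearMap.comp_apply,
      Submodule.orthogonalProjectionOnto_eq_zero_iff.2 hy', map_zero]

/-- Membership in the range of a symmetric operator, in terms of functionals. -/
theorem mem_range_iff_norm_inner_le {r : E →L[ℂ] E}
    (hr : ∀ x y, inner ℂ (r x) y = inner ℂ x (r y)) (v : E) :
    v ∈ LinearMap.range (r : E →ₗ[ℂ] E) ↔ ∃ C : ℝ, ∀ x, ‖inner ℂ v x‖ ≤ C * ‖r x‖ := by
  constructor
  · rintro ⟨w, rfl⟩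
    refine ⟨‖w‖, fun x => ?_⟩
    change ‖inner ℂ (r w) x‖ ≤ _
    rw [hr]
    exact norm_inner_le_norm _ _
  · rintro ⟨C, hC⟩
    -- The functional ⟨v, ·⟩ factors as V ∘ r; the Riesz vector of V is a preimage of v.
    obtain ⟨V, hV, -⟩ := exists_comp_eq_of_norm_le (innerSL ℂ v) r C hC
    refine ⟨(InnerProductSpace.toDual ℂ E).symm V, ?_⟩
    refine ext_inner_right ℂ fun x => ?_
    change inner ℂ (r _) x = _
    rw [hr, InnerProductSpace.toDual_symm_apply, hV]
    rfl

/-! ### The modulus, its square root, and the polar decomposition. -/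

section modulus

variable (a : E →L[ℂ] E)

theorem inner_abs_left (x y : E) : inner ℂ (CFC.abs a x) y = inner ℂ x (CFC.abs a y) :=
  ContinuousLinearMap.isSelfAdjoint_iff_isSymmetric.1
    (IsSelfAdjoint.of_nonneg (CFC.abs_nonneg a)) x y

theorem inner_sqrtAbs_left (x y : E) : inner ℂ (sqrtAbs a x) y = inner ℂ x (sqrtAbs a y) :=
  ContinuousLinearMap.isSelfAdjoint_iff_isSymmetric.1
    (IsSelfAdjoint.of_nonneg (CFC.sqrt_nonneg (CFC.abs a))) x y

theorem sqrtAbs_sqrtAbs (x : E) : sqrtAbs a (sqrtAbs a x) = CFC.abs a x :=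
  DFunLike.congr_fun (CFC.sqrt_mul_sqrt_self (CFC.abs a) (CFC.abs_nonneg a)) x

theorem norm_abs_apply (x : E) : ‖CFC.abs a x‖ = ‖a x‖ := by
  have h1 : CFC.abs a (CFC.abs a x) = ContinuousLinearMap.adjoint a (a x) :=
    DFunLike.congr_fun (CFC.abs_mul_abs a) x
  have h2 : inner ℂ (CFC.abs a x) (CFC.abs a x) = inner ℂ (a x) (a x) := by
    rw [inner_abs_left, h1, ContinuousLinearMap.adjoint_inner_right]
  rw [@norm_eq_sqrt_re_inner ℂ, h2, ← @norm_eq_sqrt_re_inner ℂ]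

theorem abs_apply_eq_zero_iff (x : E) : CFC.abs a x = 0 ↔ a x = 0 := by
  rw [← norm_eq_zero, norm_abs_apply, norm_eq_zero]

theorem sqrtAbs_apply_eq_zero_iff (x : E) : sqrtAbs a x = 0 ↔ a x = 0 := by
  rw [← abs_apply_eq_zero_iff a]
  refine ⟨fun h => by rw [← sqrtAbs_sqrtAbs, h, map_zero], fun h => ?_⟩
  rw [← inner_self_eq_zero (𝕜 := ℂ), inner_sqrtAbs_left, sqrtAbs_sqrtAbs, h, inner_zero_right]

theorem norm_sqrtAbs_sq (x : E) : ‖sqrtAbs a x‖ ^ 2 = (inner ℂ (CFC.abs a x) x).re := by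
  rw [@norm_sq_eq_re_inner ℂ, ← inner_sqrtAbs_left, sqrtAbs_sqrtAbs]
  rfl

omit [CompleteSpace G] in
variable {a} in
/-- Operators that agree on `R(|a|)` and on `N(a)` are equal. -/
theorem ext_of_abs_of_ker {A B : E →L[ℂ] G} (h1 : ∀ x, A (CFC.abs a x) = B (CFC.abs a x))
    (h2 : ∀ x, a x = 0 → A x = B x) : A = B := by
  let K := (LinearMap.range ((CFC.abs a : E →L[ℂ] E) : E →ₗ[ℂ] E)).topologicalClosure
  have : CompleteSpace K := (Submodule.isClosed_topologicalClosure _).completeSpace_coe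
  ext x
  obtain ⟨p, hp, q, hq, rfl⟩ := K.exists_add_mem_mem_orthogonal x
  have hp' : A p = B p := by
    refine closure_minimal (t := {v | A v = B v}) ?_
      (isClosed_eq (by fun_prop) (by fun_prop)) hp
    rintro _ ⟨w, rfl⟩
    exact h1 w
  have hq' : a q = 0 := by
    rw [← abs_apply_eq_zero_iff, ← inner_self_eq_zero (𝕜 := ℂ), ← inner_abs_left]
    exact hq _ (subset_closure ⟨_, rfl⟩)
  rw [map_add, map_add, hp', h2 q hq']

/-- Existence of the polar decomposition. -/
theorem exists_isPolarPart : ∃ u, IsPolarPart a u := by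
  -- Since ‖|a|x‖ = ‖ax‖, the map |a|x ↦ ax is isometric; its extension vanishes on R(|a|)ᗮ = N(a).
  obtain ⟨u, hu, hu0⟩ := exists_comp_eq_of_norm_le a (CFC.abs a) 1
    (fun x => by rw [norm_abs_apply, one_mul])
  let K := (LinearMap.range ((CFC.abs a : E →L[ℂ] E) : E →ₗ[ℂ] E)).topologicalClosure
  have hKC : CompleteSpace K := (Submodule.isClosed_topologicalClosure _).completeSpace_coe
  have hK : Kᗮ = LinearMap.ker (a : E →ₗ[ℂ] E) := by
    rw [Submodule.orthogonal_closure]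
    ext x
    rw [Submodule.mem_orthogonal, LinearMap.mem_ker]
    change _ ↔ a x = 0
    rw [← abs_apply_eq_zero_iff]
    constructor
    · intro h
      rw [← inner_self_eq_zero (𝕜 := ℂ), ← inner_abs_left]
      exact h _ ⟨_, rfl⟩
    · rintro h _ ⟨w, rfl⟩
      change inner ℂ (CFC.abs a w) x = 0
      rw [inner_abs_left, h, inner_zero_right]
  have hiso (x : E) (hx : x ∈ K) : ‖u x‖ = ‖x‖ := by
    refine closure_minimal (t := {v | ‖u v‖ = ‖v‖}) ?_
      (isClosed_eq (by fun_prop) (by fun_prop)) hx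
    rintro _ ⟨w, rfl⟩
    change ‖u (CFC.abs a w)‖ = ‖CFC.abs a w‖
    rw [hu, norm_abs_apply]
  have hker : LinearMap.ker (u : E →ₗ[ℂ] E) = LinearMap.ker (a : E →ₗ[ℂ] E) := by
    refine le_antisymm (fun x hx => ?_) (fun x hx => ?_)
    · obtain ⟨p, hp, q, hq, rfl⟩ := K.exists_add_mem_mem_orthogonal x
      have hq0 : u q = 0 := hu0 q (by rwa [Submodule.orthogonal_closure] at hq)
      have hx' : u (p + q) = 0 := hx
      rw [map_add, hq0, add_zero] at hx'
      have : p = 0 := by rw [← norm_eq_zero, ← hiso p hp, hx', norm_zero]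
      rw [this, zero_add, ← hK]
      exact hq
    · rw [← hK, Submodule.orthogonal_closure] at hx
      exact hu0 x hx
  refine ⟨u, fun x hx => hiso x ?_, hker, ContinuousLinearMap.ext fun x => (hu x).symm⟩
  rwa [hker, ← hK, Submodule.orthogonal_orthogonal] at hx

end modulus

/-! ### Algebra of the polar part u of a selfadjoint a. -/

namespace IsPolarPart

variable {a u : E →L[ℂ] E} (hu : IsPolarPart a u) (ha : IsSelfAdjoint a)

include hu

theorem apply_abs (x : E) : u (CFC.abs a x) = a x :=
  (DFunLike.congr_fun hu.eq_mul x).symm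

theorem apply_eq_zero_iff (x : E) : u x = 0 ↔ a x = 0 := by
  have := congrArg (x ∈ ·) hu.ker_eq
  simpa using this

include ha

/-- On N(a) both sides vanish; on R(|a|), u turns |a| into a, which commutes with |a|^{1/2}. -/
theorem apply_sqrtAbs (x : E) : u (sqrtAbs a x) = sqrtAbs a (u x) := by
  have hc := (CFC.commute_abs_self a ha.isStarNormal).cfcₙ_nnreal NNReal.sqrt
  have hc' (z : E) : sqrtAbs a (a z) = a (sqrtAbs a z) := DFunLike.congr_fun hc.eq z
  refine DFunLike.congr_fun (ext_of_abs_of_ker (a := a) (A := u ∘L sqrtAbs a)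
    (B := sqrtAbs a ∘L u) (fun x => ?_) fun x hx => ?_) x
  · simp only [ContinuousLinearMap.comp_apply]
    rw [hu.apply_abs, ← sqrtAbs_sqrtAbs, sqrtAbs_sqrtAbs a (sqrtAbs a x), hu.apply_abs, hc']
  · simp only [ContinuousLinearMap.comp_apply]
    rw [(sqrtAbs_apply_eq_zero_iff a x).2 hx, (hu.apply_eq_zero_iff x).2 hx, map_zero, map_zero]

theorem sqrtAbs_apply_sqrtAbs (x : E) : sqrtAbs a (u (sqrtAbs a x)) = a x := by
  rw [← hu.apply_sqrtAbs ha, sqrtAbs_sqrtAbs, hu.apply_abs]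

theorem abs_apply (x : E) : CFC.abs a (u x) = a x := by
  rw [← sqrtAbs_sqrtAbs, ← hu.apply_sqrtAbs ha, hu.sqrtAbs_apply_sqrtAbs ha]

/-- On R(|a|) the claim reduces to |a|ua = a² = |a|², because |a| and |a|^{1/2} have the same
kernel. Thus u is an involution on the closure of R(|a|^{1/2}). -/
theorem apply_apply_sqrtAbs (x : E) : u (u (sqrtAbs a x)) = sqrtAbs a x := by
  have haa (z : E) : CFC.abs a (CFC.abs a z) = a (a z) := by
    have := DFunLike.congr_fun (CFC.abs_mul_abs a) z
    rwa [ha.star_eq] at this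
  refine DFunLike.congr_fun (ext_of_abs_of_ker (a := a) (A := u ∘L u ∘L sqrtAbs a)
    (B := sqrtAbs a) (fun x => ?_) fun x hx => ?_) x
  · simp only [ContinuousLinearMap.comp_apply]
    rw [hu.apply_sqrtAbs ha, hu.apply_sqrtAbs ha, hu.apply_abs, ← sub_eq_zero, ← map_sub,
      sqrtAbs_apply_eq_zero_iff, ← abs_apply_eq_zero_iff, map_sub, hu.abs_apply ha, haa, sub_self]
  · simp only [ContinuousLinearMap.comp_apply]
    rw [(sqrtAbs_apply_eq_zero_iff a x).2 hx, map_zero, map_zero]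

/-- On R(|a|), u* agrees with u because |a|u = a = u|a|. On N(a) both vanish, because N(a) is
orthogonal to R(a) and hence to R(u). -/
theorem inner_apply_left (x y : E) : inner ℂ (u x) y = inner ℂ x (u y) := by
  have hs := ContinuousLinearMap.isSelfAdjoint_iff_isSymmetric.1 ha
  have key : ContinuousLinearMap.adjoint u = u := by
    refine ext_of_abs_of_ker (a := a) (fun x => ?_) fun x hx => ?_
    · refine ext_inner_right ℂ fun z => ?_
      rw [ContinuousLinearMap.adjoint_inner_left, inner_abs_left, hu.abs_apply ha, hu.apply_abs]
      exact (hs x z).symm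
    · rw [(hu.apply_eq_zero_iff x).2 hx]
      refine ext_inner_right ℂ fun z => ?_
      rw [ContinuousLinearMap.adjoint_inner_left, inner_zero_left]
      refine DFunLike.congr_fun (ext_of_abs_of_ker (a := a) (A := innerSL ℂ x ∘L u) (B := 0)
        (fun w => ?_) fun w hw => ?_) z
      · change inner ℂ x (u (CFC.abs a w)) = 0
        rw [hu.apply_abs]
        refine (hs x w).symm.trans ?_
        change inner ℂ (a x) w = 0
        rw [hx, inner_zero_left]
      · change inner ℂ x (u w) = 0
        rw [(hu.apply_eq_zero_iff w).2 hw, inner_zero_right]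
  rw [← ContinuousLinearMap.adjoint_inner_right, key]

end IsPolarPart

/-! ### Löwner–Heinz and invariance under congruence. -/

/-- The Löwner–Heinz inequality for the square root, in terms of norms and quadratic forms. -/
theorem re_inner_le_of_norm_le {P Q : E →L[ℂ] E} (hP : 0 ≤ P) (hQ : 0 ≤ Q) {C : ℝ} (hC : 0 ≤ C)
    (h : ∀ x, ‖P x‖ ≤ C * ‖Q x‖) (x : E) :
    (inner ℂ (P x) x).re ≤ C * (inner ℂ (Q x) x).re := by
  have hP' := ContinuousLinearMap.isSelfAdjoint_iff_isSymmetric.1 (IsSelfAdjoint.of_nonneg hP)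
  have hQ' : 0 ≤ (C : ℂ) • Q := by
    rw [ContinuousLinearMap.nonneg_iff_isPositive] at hQ ⊢
    exact hQ.smul_of_nonneg (by exact_mod_cast hC)
  have hQ'' := ContinuousLinearMap.isSelfAdjoint_iff_isSymmetric.1 (IsSelfAdjoint.of_nonneg hQ')
  -- The norm bound is the operator inequality P² ≤ (CQ)²; operator monotonicity of the square root
  -- gives P ≤ CQ.
  have hsq : P * P ≤ ((C : ℂ) • Q) * ((C : ℂ) • Q) := by
    rw [ContinuousLinearMap.le_def, ContinuousLinearMap.isPositive_def']
    refine ⟨?_, fun x => ?_⟩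
    · have hs {A : E →L[ℂ] E} (hA : 0 ≤ A) : IsSelfAdjoint (A * A) :=
        (IsSelfAdjoint.of_nonneg hA).commute_iff (IsSelfAdjoint.of_nonneg hA) |>.1 (Commute.refl A)
      exact (hs hQ').sub (hs hP)
    · have e1 : inner ℂ (P (P x)) x = inner ℂ (P x) (P x) := hP' (P x) x
      have e2 : inner ℂ (((C : ℂ) • Q) (((C : ℂ) • Q) x)) x =
        inner ℂ (((C : ℂ) • Q) x) (((C : ℂ) • Q) x) := hQ'' _ x
      rw [ContinuousLinearMap.reApplyInnerSelf_apply]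
      change 0 ≤ RCLike.re (inner ℂ (((C : ℂ) • Q) (((C : ℂ) • Q) x) - P (P x)) x)
      rw [inner_sub_left, e1, e2, map_sub, ← norm_sq_eq_re_inner, ← norm_sq_eq_re_inner,
        sub_nonneg]
      have : ‖((C : ℂ) • Q) x‖ = C * ‖Q x‖ := by
        rw [smul_apply, norm_smul, Complex.norm_real, Real.norm_of_nonneg hC]
      rw [this]
      exact pow_le_pow_left₀ (norm_nonneg _) (h x) 2
  have hle : P ≤ (C : ℂ) • Q := by
    have := CFC.sqrt_le_sqrt _ _ hsq
    rwa [CFC.sqrt_mul_self P hP, CFC.sqrt_mul_self _ hQ'] at this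
  have := (ContinuousLinearMap.le_def _ _).1 hle |>.re_inner_nonneg_left x
  rw [sub_apply, inner_sub_left, smul_apply,
    inner_smul_left] at this
  simpa using this

section congruence

variable {a₁ : E →L[ℂ] E} {a₂ : F →L[ℂ] F} (T : E ≃L[ℂ] F)
  (h : ∀ x y, inner ℂ (a₁ x) y = inner ℂ (a₂ (T x)) (T y))

include h

/-- The forms of `|a|` and `|T* a T|` are comparable when `T` is invertible. -/
theorem exists_norm_sqrtAbs_le : ∃ C : ℝ, ∀ x, ‖sqrtAbs a₂ (T x)‖ ≤ C * ‖sqrtAbs a₁ x‖ := by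
  let t : E →L[ℂ] F := T
  -- Since a₂T = (T⁻¹)* a₁, the operator P = T*|a₂|T satisfies ‖Px‖ ≤ ‖T‖‖T⁻¹‖ ‖|a₁|x‖. Löwner–Heinz
  -- turns this into a bound between the forms, whose values are squares of norms; hence the
  -- constant `Real.sqrt C` below.
  let P : E →L[ℂ] E := ContinuousLinearMap.adjoint t ∘L CFC.abs a₂ ∘L t
  have hP : 0 ≤ P := by
    rw [ContinuousLinearMap.nonneg_iff_isPositive]
    exact ((ContinuousLinearMap.nonneg_iff_isPositive _).1 (CFC.abs_nonneg a₂)).adjoint_conj t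
  have hbound (x : E) : ‖a₂ (T x)‖ ≤ ‖(T.symm : F →L[ℂ] E)‖ * ‖a₁ x‖ := by
    have e : a₂ (T x) = ContinuousLinearMap.adjoint (T.symm : F →L[ℂ] E) (a₁ x) := by
      refine ext_inner_right ℂ fun z => ?_
      rw [ContinuousLinearMap.adjoint_inner_left, h]
      simp
    rw [e]
    refine (ContinuousLinearMap.le_opNorm _ _).trans ?_
    rw [LinearIsometryEquiv.norm_map]
  set C := ‖t‖ * ‖(T.symm : F →L[ℂ] E)‖ with hC
  have hPQ (x : E) : ‖P x‖ ≤ C * ‖CFC.abs a₁ x‖ := by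
    refine (ContinuousLinearMap.le_opNorm (ContinuousLinearMap.adjoint t) _).trans ?_
    rw [LinearIsometryEquiv.norm_map, hC, mul_assoc, norm_abs_apply]
    gcongr
    change ‖CFC.abs a₂ (T x)‖ ≤ _
    rw [norm_abs_apply]
    exact hbound x
  have hC0 : 0 ≤ C := by positivity
  refine ⟨Real.sqrt C, fun x => ?_⟩
  refine le_of_sq_le_sq ?_ (by positivity)
  rw [mul_pow, Real.sq_sqrt hC0, norm_sqrtAbs_sq, norm_sqrtAbs_sq]
  have := re_inner_le_of_norm_le hP (CFC.abs_nonneg a₁) hC0 hPQ x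
  have e : inner ℂ (P x) x = inner ℂ (CFC.abs a₂ (T x)) (T x) :=
    ContinuousLinearMap.adjoint_inner_left t _ _
  rwa [e] at this

theorem mem_range_sqrtAbs_of_congr {v : E} {w : F} (hvw : ∀ x, inner ℂ v x = inner ℂ w (T x))
    (hw : w ∈ LinearMap.range (sqrtAbs a₂ : F →ₗ[ℂ] F)) :
    v ∈ LinearMap.range (sqrtAbs a₁ : E →ₗ[ℂ] E) := by
  rw [mem_range_iff_norm_inner_le (inner_sqrtAbs_left _)] at hw ⊢
  obtain ⟨C, hC⟩ := hw
  obtain ⟨C', hC'⟩ := exists_norm_sqrtAbs_le T h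
  -- The sign of `C` is unknown, so `|C|` is used to multiply the second bound.
  refine ⟨|C| * C', fun x => ?_⟩
  rw [hvw, mul_assoc]
  refine (hC _).trans ?_
  refine (mul_le_mul_of_nonneg_right (le_abs_self C) (norm_nonneg _)).trans ?_
  exact mul_le_mul_of_nonneg_left (hC' x) (abs_nonneg C)

theorem mem_range_sqrtAbs_iff_of_congr {v : E} {w : F}
    (hvw : ∀ x, inner ℂ v x = inner ℂ w (T x)) :
    v ∈ LinearMap.range (sqrtAbs a₁ : E →ₗ[ℂ] E) ↔
      w ∈ LinearMap.range (sqrtAbs a₂ : F →ₗ[ℂ] F) := by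
  refine ⟨mem_range_sqrtAbs_of_congr T.symm (fun x y => ?_) (fun x => ?_),
    mem_range_sqrtAbs_of_congr T h hvw⟩
  · rw [h]; simp
  · rw [hvw]; simp

/-- The form `⟨u g, g'⟩` on functionals `⟨r g, ·⟩`, `r = |a|^{1/2}`, is invariant under
congruence. -/
theorem inner_polarPart_congr {u₁ : E →L[ℂ] E} {u₂ : F →L[ℂ] F} (hu₁ : IsPolarPart a₁ u₁)
    (hu₂ : IsPolarPart a₂ u₂) (ha₁ : IsSelfAdjoint a₁) (ha₂ : IsSelfAdjoint a₂) {g g' : E}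
    {k k' : F} (hg : ∀ x, inner ℂ (sqrtAbs a₁ g) x = inner ℂ (sqrtAbs a₂ k) (T x))
    (hg' : ∀ x, inner ℂ (sqrtAbs a₁ g') x = inner ℂ (sqrtAbs a₂ k') (T x)) :
    inner ℂ (u₁ g) g' = inner ℂ (u₂ k) k' := by
  obtain ⟨C, hC⟩ := exists_norm_sqrtAbs_le T h
  -- With rᵢ = |aᵢ|^{1/2}, V satisfies V r₁ = r₂ T, so that r₁ V* = T* r₂.
  obtain ⟨V, hV, -⟩ := exists_comp_eq_of_norm_le (sqrtAbs a₂ ∘L (T : E →L[ℂ] F)) (sqrtAbs a₁) C hC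
  have hV' (x : E) : V (sqrtAbs a₁ x) = sqrtAbs a₂ (T x) := hV x
  set V' := ContinuousLinearMap.adjoint V
  have hker (x : E) : sqrtAbs a₁ x = 0 ↔ u₁ x = 0 := by
    rw [sqrtAbs_apply_eq_zero_iff, hu₁.apply_eq_zero_iff]
  have hr (w : F) (z : E) : inner ℂ (sqrtAbs a₁ (V' w)) z = inner ℂ (sqrtAbs a₂ w) (T z) := by
    rw [inner_sqrtAbs_left, ContinuousLinearMap.adjoint_inner_left, hV', inner_sqrtAbs_left]
  -- V transports one polar part to the other. For Tx = u₂r₂z one has |a₂|z = u₂r₂Tx. Applying r₁ to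
  -- V*u₂r₂Tx gives T*a₂Tx = a₁x = r₁u₁r₁x, so u₁V*u₂r₂Tx = u₁u₁r₁x = r₁x, and V r₁x = r₂Tx.
  have hVu (w : F) : V (u₁ (V' w)) = u₂ w := by
    refine DFunLike.congr_fun (ext_of_abs_of_ker (a := a₂) (A := V ∘L u₁ ∘L V') (B := u₂)
      (fun z => ?_) fun z hz => ?_) w
    · obtain ⟨x, hx⟩ := T.surjective (u₂ (sqrtAbs a₂ z))
      have hz : CFC.abs a₂ z = u₂ (sqrtAbs a₂ (T x)) := by
        rw [hx, ← hu₂.apply_sqrtAbs ha₂, hu₂.apply_apply_sqrtAbs ha₂, sqrtAbs_sqrtAbs]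
      have h0 : u₁ (V' (u₂ (sqrtAbs a₂ (T x)))) = sqrtAbs a₁ x := by
        rw [← hu₁.apply_apply_sqrtAbs ha₁ x, ← sub_eq_zero, ← map_sub, ← hker, map_sub,
          sub_eq_zero, hu₁.sqrtAbs_apply_sqrtAbs ha₁]
        refine ext_inner_right ℂ fun z => ?_
        rw [hr, hu₂.sqrtAbs_apply_sqrtAbs ha₂, h]
      simp only [ContinuousLinearMap.comp_apply]
      rw [hz, h0, hV', hu₂.apply_apply_sqrtAbs ha₂]
    · have h0 : u₁ (V' z) = 0 := by
        rw [← hker]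
        refine ext_inner_right ℂ fun x => ?_
        rw [hr, (sqrtAbs_apply_eq_zero_iff a₂ z).2 hz, inner_zero_left, inner_zero_left]
      simp only [ContinuousLinearMap.comp_apply]
      rw [h0, map_zero, (hu₂.apply_eq_zero_iff z).2 hz]
  -- The vectors g and V*k have the same image under r₁, so they differ by an element of N(r₁) =
  -- N(u₁).
  have hgk {g : E} {k : F}
      (hg : ∀ x, inner ℂ (sqrtAbs a₁ g) x = inner ℂ (sqrtAbs a₂ k) (T x)) :
      u₁ g = u₁ (V' k) := by
    rw [← sub_eq_zero, ← map_sub, ← hker, map_sub, sub_eq_zero]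
    exact ext_inner_right ℂ fun x => by rw [hg, hr]
  rw [hu₁.inner_apply_left ha₁, hgk hg', ← hu₁.inner_apply_left ha₁, hgk hg,
    ContinuousLinearMap.adjoint_inner_right, hVu]

end congruence

/-! ### Reduced solutions and block entries. -/

/-- Existence of the reduced solution. -/
theorem exists_isReducedSolution (Z : F →L[ℂ] G) (Y : E →L[ℂ] G)
    (h : LinearMap.range (Z : F →ₗ[ℂ] G) ≤ LinearMap.range (Y : E →ₗ[ℂ] G)) :
    ∃ X, IsReducedSolution Z Y X := by
  let N := LinearMap.ker (Y : E →ₗ[ℂ] G)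
  have hN : IsClosed (N : Set E) := ContinuousLinearMap.isClosed_ker Y
  have : CompleteSpace N := hN.completeSpace_coe
  have hY (v : E) (hv : v ∈ N) : Y v = 0 := hv
  have hinj : Function.Injective ((Y : E →ₗ[ℂ] G) ∘ₗ Nᗮ.subtype) := by
    rw [← LinearMap.ker_eq_bot, LinearMap.ker_eq_bot']
    intro v hv
    have : (v : E) ∈ N ⊓ Nᗮ := ⟨hv, v.2⟩
    rw [N.inf_orthogonal_eq_bot] at this
    exact Subtype.ext this
  have hex (z : F) : Z z ∈ LinearMap.range ((Y : E →ₗ[ℂ] G) ∘ₗ Nᗮ.subtype) := by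
    obtain ⟨w, hw⟩ := h ⟨z, rfl⟩
    obtain ⟨p, hp, q, hq, rfl⟩ := N.exists_add_mem_mem_orthogonal w
    refine ⟨⟨q, hq⟩, ?_⟩
    have hw' : Y (p + q) = Z z := hw
    rw [map_add, hY p hp, zero_add] at hw'
    exact hw'
  let X₀ : F →ₗ[ℂ] Nᗮ := (LinearEquiv.ofInjective _ hinj).symm.toLinearMap ∘ₗ
    (Z : F →ₗ[ℂ] G).codRestrict _ hex
  have hX₀ (z : F) : Y (X₀ z) = Z z := by
    have := LinearEquiv.ofInjective_symm_apply (f := (Y : E →ₗ[ℂ] G) ∘ₗ Nᗮ.subtype) (h := hinj)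
      ⟨Z z, hex z⟩
    exact this
  -- The graph of X₀ is closed because Y is continuous and injective on N(Y)ᗮ.
  have hc : Continuous X₀ := by
    refine X₀.continuous_of_seq_closed_graph fun s x y hs hy => ?_
    refine hinj ?_
    change Y y = Y (X₀ x)
    rw [hX₀]
    refine tendsto_nhds_unique (((Y.continuous.comp continuous_subtype_val).tendsto y).comp hy) ?_
    refine ((Z.continuous.tendsto x).comp hs).congr fun n => ?_
    exact (hX₀ (s n)).symm
  refine ⟨Nᗮ.subtypeL ∘L ⟨X₀, hc⟩, ContinuousLinearMap.ext fun z => (hX₀ z).symm, ?_, ?_⟩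
  · ext z
    rw [LinearMap.mem_ker, LinearMap.mem_ker]
    change (X₀ z : E) = 0 ↔ Z z = 0
    refine ⟨fun hz => by rw [← hX₀, hz, map_zero], fun hz => ?_⟩
    have : X₀ z = 0 := hinj (by rw [map_zero]; exact (hX₀ z).trans hz)
    rw [this]
    rfl
  · rintro _ ⟨z, rfl⟩
    rw [← Submodule.orthogonal_orthogonal_eq_closure, ContinuousLinearMap.orthogonal_range,
      ContinuousLinearMap.adjoint_adjoint]
    exact (X₀ z).2

section blocks

variable {B : E →L[ℂ] E} {S : Submodule ℂ E} [CompleteSpace S]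

omit [CompleteSpace E] in
theorem inner_blockA_left (x y : S) : inner ℂ (blockA B S x) y = inner ℂ (B x) (y : E) :=
  Submodule.inner_orthogonalProjectionOnto_eq_of_mem_right y _

omit [CompleteSpace E] in
theorem inner_blockB_left (x : Sᗮ) (y : S) : inner ℂ (blockB B S x) y = inner ℂ (B x) (y : E) :=
  Submodule.inner_orthogonalProjectionOnto_eq_of_mem_right y _

omit [CompleteSpace E] in
theorem inner_blockC_left (x y : Sᗮ) : inner ℂ (blockC B S x) y = inner ℂ (B x) (y : E) :=
  Submodule.inner_orthogonalProjectionOnto_eq_of_mem_right y _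

theorem isSelfAdjoint_blockA (hB : IsSelfAdjoint B) : IsSelfAdjoint (blockA B S) := by
  have hs := ContinuousLinearMap.isSelfAdjoint_iff_isSymmetric.1 hB
  rw [ContinuousLinearMap.isSelfAdjoint_iff_isSymmetric]
  intro x y
  change inner ℂ (blockA B S x) y = inner ℂ x (blockA B S y)
  rw [← inner_conj_symm x, inner_blockA_left, inner_blockA_left, inner_conj_symm]
  exact hs x y

end blocks

end HilbertSchur

/-! ### Recognizing Krein spaces; their topology and regular subspaces. -/

namespace IndefiniteMetric

variable {H : Type*} [AddCommGroup H] [Module ℂ H]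

/-- A metric that is the pullback of an inner product along an injective map with closed range
makes the space a Hilbert space. -/
theorem isHilbert_of_inner {E : Type*} [NormedAddCommGroup E] [InnerProductSpace ℂ E]
    [CompleteSpace E] {κ : IndefiniteMetric H} (φ : H →ₗ[ℂ] E) (hφ : Function.Injective φ)
    (hc : IsClosed (Set.range φ)) (h : ∀ x y, κ.form x y = inner ℂ (φ x) (φ y)) :
    κ.IsHilbert := by
  have hpos : κ.IsPositiveDefinite := by
    intro x hx
    rw [h, ← RCLike.re_eq_complex_re, ← norm_sq_eq_re_inner]
    have : φ x ≠ 0 := fun h0 => hx (hφ (by rw [h0, map_zero]))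
    positivity
  refine ⟨hpos, ?_⟩
  let ψ : κ.InnerSpace hpos →ₗᵢ[ℂ] E :=
    { toLinearMap := φ ∘ₗ ((κ.toInnerSpace hpos).symm : κ.InnerSpace hpos →ₗ[ℂ] H)
      norm_map' := fun x => by
        obtain ⟨x, rfl⟩ := (κ.toInnerSpace hpos).surjective x
        rw [← sq_eq_sq₀ (norm_nonneg _) (norm_nonneg _), norm_sq_def, h,
          ← RCLike.re_eq_complex_re, ← norm_sq_eq_re_inner]
        simp }
  have hr : Set.range ψ = Set.range φ := by
    ext v
    constructor
    · rintro ⟨x, rfl⟩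
      exact ⟨_, rfl⟩
    · rintro ⟨x, rfl⟩
      exact ⟨κ.toInnerSpace hpos x, rfl⟩
  rw [completeSpace_iff_isComplete_range ψ.isometry.isUniformInducing, hr]
  exact hc.isComplete

/-- A metric given by a symmetric involution of a Hilbert space makes the space a Krein space. -/
theorem isKrein_of_involution {E : Type*} [NormedAddCommGroup E] [InnerProductSpace ℂ E]
    [CompleteSpace E] {κ : IndefiniteMetric H} (e : H ≃ₗ[ℂ] E) (u : E →L[ℂ] E)
    (hu : ∀ x y, inner ℂ (u x) y = inner ℂ x (u y)) (huu : ∀ x, u (u x) = x)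
    (h : ∀ x y, κ.form x y = inner ℂ (u (e x)) (e y)) : κ.IsKrein := by
  -- The fundamental decomposition consists of the eigenspaces of u for 1 and -1.
  let pos : Submodule ℂ H :=
    (LinearMap.eqLocus (u : E →ₗ[ℂ] E) LinearMap.id).comap (e : H →ₗ[ℂ] E)
  let neg : Submodule ℂ H :=
    (LinearMap.eqLocus (u : E →ₗ[ℂ] E) (-LinearMap.id)).comap (e : H →ₗ[ℂ] E)
  have hpos {x : H} : x ∈ pos ↔ u (e x) = e x := Iff.rfl
  have hneg {x : H} : x ∈ neg ↔ u (e x) = -e x := Iff.rfl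
  have hcl (p : Submodule ℂ H) (v : E →L[ℂ] E) (hp : ∀ x, x ∈ p ↔ u (e x) = v (e x)) :
      IsClosed (Set.range ((e : H →ₗ[ℂ] E) ∘ₗ p.subtype)) := by
    have : Set.range ((e : H →ₗ[ℂ] E) ∘ₗ p.subtype) = {w | u w = v w} := by
      ext w
      constructor
      · rintro ⟨x, rfl⟩
        exact (hp x).1 x.2
      · intro hw
        refine ⟨⟨e.symm w, (hp _).2 ?_⟩, ?_⟩
        · rw [e.apply_symm_apply]
          exact hw
        · exact e.apply_symm_apply w
    rw [this]
    exact isClosed_eq (by fun_prop) (by fun_prop)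
  refine ⟨⟨pos, neg, ⟨?_, ?_⟩, ?_, ?_, ?_⟩⟩
  · rw [Submodule.disjoint_def]
    intro x hx hx'
    have h1 : e x = -e x := (hpos.1 hx).symm.trans (hneg.1 hx')
    rw [← sub_eq_zero, sub_neg_eq_add, ← two_smul ℂ, smul_eq_zero_iff_right two_ne_zero] at h1
    exact e.map_eq_zero_iff.1 h1
  · rw [codisjoint_iff, Submodule.eq_top_iff']
    intro x
    rw [Submodule.mem_sup]
    refine ⟨e.symm ((2⁻¹ : ℂ) • (e x + u (e x))), ?_, e.symm ((2⁻¹ : ℂ) • (e x - u (e x))), ?_, ?_⟩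
    · rw [hpos, e.apply_symm_apply, map_smul, map_add, huu, add_comm]
    · rw [hneg, e.apply_symm_apply, map_smul, map_sub, huu, ← smul_neg, neg_sub]
    · rw [← map_add, ← smul_add, add_add_sub_cancel, ← two_smul ℂ (e x), smul_smul]
      simp
  · intro x hx y hy
    have h1 : κ.form x y = inner ℂ (e x) (e y) := by rw [h, hpos.1 hx]
    have h2 : κ.form x y = -inner ℂ (e x) (e y) := by rw [h, hu, hneg.1 hy, inner_neg_right]
    rw [← h1] at h2
    exact self_eq_neg.1 h2
  · refine isHilbert_of_inner ((e : H →ₗ[ℂ] E) ∘ₗ pos.subtype)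
      (e.injective.comp Subtype.val_injective) (hcl _ (ContinuousLinearMap.id ℂ E) fun x => hpos)
      fun x y => ?_
    change κ.form x y = inner ℂ (e x) (e y)
    rw [h, hpos.1 x.2]
  · refine isHilbert_of_inner ((e : H →ₗ[ℂ] E) ∘ₗ neg.subtype)
      (e.injective.comp Subtype.val_injective) (hcl _ (-ContinuousLinearMap.id ℂ E) fun x => hneg)
      fun x y => ?_
    change -κ.form x y = inner ℂ (e x) (e y)
    rw [h, hneg.1 x.2, inner_neg_left, neg_neg]

namespace FundamentalDecomposition

variable {κ : IndefiniteMetric H} (D : κ.FundamentalDecomposition)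

theorem form_eq_inner (x y : H) :
    κ.form x y = inner ℂ (D.toHilbert (D.signature x)) (D.toHilbert y) := by
  rw [inner_toHilbert, signature_signature]

theorem continuous_form (y : H) :
    Continuous fun x : D.Hilbert => κ.form y (D.toHilbert.symm x) := by
  have : (fun x : D.Hilbert => κ.form y (D.toHilbert.symm x)) =
      fun x => inner ℂ (D.toHilbert (D.signature y)) x := by
    funext x
    rw [D.form_eq_inner, LinearEquiv.apply_symm_apply]
  rw [this]
  fun_prop

include D in
theorem eq_zero_of_form {x : H} (h : ∀ y, κ.form y x = 0) : x = 0 := by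
  have := h (D.signature x)
  rw [← inner_toHilbert, inner_self_eq_zero] at this
  exact D.toHilbert.map_eq_zero_iff.1 this

include D in
theorem ext_form {x x' : H} (h : ∀ y, κ.form x y = κ.form x' y) : x = x' := by
  rw [← sub_eq_zero]
  refine D.eq_zero_of_form fun y => ?_
  rw [map_sub, ← κ.symm.eq x y, ← κ.symm.eq x' y, h, sub_self]

/-- A map into a Krein space is continuous if it is so weakly, on a separating set. -/
theorem continuous_toHilbert_comp {X : Type*} [NormedAddCommGroup X] [NormedSpace ℂ X]
    [CompleteSpace X] (A : X →ₗ[ℂ] H) (s : Set H)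
    (hs : ∀ x, (∀ y ∈ s, κ.form y x = 0) → x = 0)
    (hA : ∀ y ∈ s, Continuous fun x => κ.form y (A x)) :
    Continuous ((D.toHilbert : H →ₗ[ℂ] D.Hilbert) ∘ₗ A) := by
  -- The closed graph theorem applies: the functionals from `s` identify the limit.
  refine LinearMap.continuous_of_seq_closed_graph _ fun t x z ht hz => ?_
  obtain ⟨z, rfl⟩ := D.toHilbert.surjective z
  change D.toHilbert z = D.toHilbert (A x)
  congr 1
  rw [← sub_eq_zero]
  refine hs _ fun y hy => ?_
  rw [map_sub, sub_eq_zero]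
  have h1 := ((D.continuous_form y).tendsto _).comp hz
  have h2 := ((hA y hy).tendsto _).comp ht
  rw [LinearEquiv.symm_apply_apply] at h1
  exact tendsto_nhds_unique h1 (h2.congr fun n => by simp)

theorem mem_subspace_iff {S : Submodule ℂ H} {x : H} : D.toHilbert x ∈ D.subspace S ↔ x ∈ S := by
  constructor
  · rintro ⟨y, hy, hyx⟩
    rwa [← D.toHilbert.injective hyx]
  · exact fun hx => ⟨x, hx, rfl⟩

theorem mem_companion {S : Submodule ℂ H} {x : H} :
    x ∈ κ.companion S ↔ ∀ s ∈ S, κ.form s x = 0 := Iff.rfl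

theorem isClosed_companion (S : Submodule ℂ H) :
    IsClosed (D.subspace (κ.companion S) : Set D.Hilbert) := by
  have : (D.subspace (κ.companion S) : Set D.Hilbert) =
      ⋂ s ∈ S, {x | κ.form s (D.toHilbert.symm x) = 0} := by
    ext x
    obtain ⟨x, rfl⟩ := D.toHilbert.surjective x
    rw [SetLike.mem_coe, mem_subspace_iff, mem_companion]
    simp
  rw [this]
  exact isClosed_biInter fun s _ => isClosed_eq (D.continuous_form s) continuous_const

variable {S : Submodule ℂ H} (hS : κ.IsRegular S)

include D hS

/-- The S^{[⊥]}-component of a vector of S^{[⊥][⊥]} is orthogonal to both summands, so it is zero by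
nondegeneracy. -/
theorem companion_companion : κ.companion (κ.companion S) = S := by
  refine le_antisymm (fun x hx => ?_) fun x hx y hy => ?_
  · have hx' : x ∈ S ⊔ κ.companion S := by rw [hS.sup_eq_top]; trivial
    obtain ⟨s, hs, m, hm, rfl⟩ := Submodule.mem_sup.1 hx'
    have hm0 : m = 0 := by
      refine D.eq_zero_of_form fun y => ?_
      have hy : y ∈ S ⊔ κ.companion S := by rw [hS.sup_eq_top]; trivial
      obtain ⟨t, ht, n, hn, rfl⟩ := Submodule.mem_sup.1 hy
      have h1 : κ.form n (s + m) = 0 := hx n hn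
      have h2 : κ.form n s = 0 := by rw [← κ.symm.eq, show κ.form s n = 0 from hn s hs, map_zero]
      have h3 : κ.form t m = 0 := hm t ht
      rw [map_add, h2, zero_add] at h1
      rw [map_add, LinearMap.add_apply, h1, h3, add_zero]
    rwa [hm0, add_zero]
  · change κ.form y x = 0
    rw [← κ.symm.eq, show κ.form x y = 0 from hy x hx, map_zero]

theorem isRegular_companion : κ.IsRegular (κ.companion S) := by
  rw [IsRegular, D.companion_companion hS]
  exact hS.symm

/-- A regular subspace is itself a companion, and companions are closed. -/
theorem completeSpace_subspace : CompleteSpace (D.subspace S) := by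
  have := D.isClosed_companion (κ.companion S)
  rw [D.companion_companion hS] at this
  exact this.completeSpace_coe

end FundamentalDecomposition

namespace IsRegular

variable {κ : IndefiniteMetric H} {S : Submodule ℂ H} (hS : κ.IsRegular S)

theorem proj₁_add_proj₂ (x : H) : (hS.proj₁ x : H) + hS.proj₂ x = x :=
  Submodule.projection_add_projection_eq_self hS x

theorem form_companion (s : S) (m : κ.companion S) : κ.form s m = 0 := m.2 s s.2

theorem form_companion' (m : κ.companion S) (s : S) : κ.form m s = 0 := by
  rw [← κ.symm.eq, form_companion, map_zero]

theorem form_proj₁_left (x : H) (s : S) : κ.form (hS.proj₁ x) s = κ.form x s := by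
  conv_rhs => rw [← hS.proj₁_add_proj₂ x]
  rw [map_add, LinearMap.add_apply, form_companion', add_zero]

theorem form_proj₁_right (s : S) (x : H) : κ.form s (hS.proj₁ x) = κ.form s x := by
  rw [← κ.symm.eq, form_proj₁_left, κ.symm.eq]

theorem form_proj₂_left (x : H) (m : κ.companion S) : κ.form (hS.proj₂ x) m = κ.form x m := by
  conv_rhs => rw [← hS.proj₁_add_proj₂ x]
  rw [map_add, LinearMap.add_apply, form_companion, zero_add]

end IsRegular

namespace FundamentalDecomposition

variable {κ : IndefiniteMetric H} (D : κ.FundamentalDecomposition)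

/-- A symmetric operator on a Krein space is bounded. -/
theorem exists_isSignatureMul {W : H →ₗ[ℂ] H} (hW : κ.IsAdjoint κ W W) :
    ∃ B, D.IsSignatureMul W B := by
  let A : D.Hilbert →ₗ[ℂ] H := D.signature ∘ₗ W ∘ₗ (D.toHilbert.symm : D.Hilbert →ₗ[ℂ] H)
  have hA : Continuous ((D.toHilbert : H →ₗ[ℂ] D.Hilbert) ∘ₗ A) := by
    -- Hellinger–Toeplitz: [y, JWx] = [WJy, x] is continuous in x for every y.
    refine D.continuous_toHilbert_comp A Set.univ
      (fun x hx => D.eq_zero_of_form fun y => hx y trivial) fun y _ => ?_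
    refine (D.continuous_form (W (D.signature y))).congr fun x => ?_
    change _ = κ.form y (D.signature (W _))
    rw [D.form_signature_right, hW]
    rfl
  refine ⟨⟨_, hA⟩, fun x => ?_⟩
  change D.toHilbert (D.signature (W (D.toHilbert.symm (D.toHilbert x)))) = _
  rw [LinearEquiv.symm_apply_apply]

theorem IsSignatureMul.inner_left {D : κ.FundamentalDecomposition} {W : H →ₗ[ℂ] H}
    {B : D.Hilbert →L[ℂ] D.Hilbert} (hB : D.IsSignatureMul W B) (x y : D.Hilbert) :
    inner ℂ (B x) y = κ.form (W (D.toHilbert.symm x)) (D.toHilbert.symm y) := by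
  obtain ⟨x, rfl⟩ := D.toHilbert.surjective x
  obtain ⟨y, rfl⟩ := D.toHilbert.surjective y
  rw [hB, inner_toHilbert, signature_signature, LinearEquiv.symm_apply_apply,
    LinearEquiv.symm_apply_apply]

theorem IsSignatureMul.isSelfAdjoint {D : κ.FundamentalDecomposition}
    {W : H →ₗ[ℂ] H} {B : D.Hilbert →L[ℂ] D.Hilbert} (hB : D.IsSignatureMul W B)
    (hW : κ.IsAdjoint κ W W) : IsSelfAdjoint B := by
  rw [ContinuousLinearMap.isSelfAdjoint_iff_isSymmetric]
  intro x y
  change inner ℂ (B x) y = inner ℂ x (B y)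
  rw [hB.inner_left, hW, ← κ.symm.eq, ← hB.inner_left]
  exact inner_conj_symm _ _

theorem IsSignatureMul.inner_blockA {D : κ.FundamentalDecomposition} {W : H →ₗ[ℂ] H}
    {B : D.Hilbert →L[ℂ] D.Hilbert} (hB : D.IsSignatureMul W B) {S : Submodule ℂ H}
    [CompleteSpace (D.subspace S)] (x y : D.subspace S) :
    inner ℂ (HilbertSchur.blockA B (D.subspace S) x) y =
      κ.form (W (D.toHilbert.symm (x : D.Hilbert))) (D.toHilbert.symm (y : D.Hilbert)) := by
  rw [← hB.inner_left]
  exact Submodule.inner_orthogonalProjectionOnto_eq_of_mem_right y _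

end FundamentalDecomposition

/-- A regular subspace of a Krein space is a Krein space. -/
theorem IsRegular.isKrein_restrict {κ : IndefiniteMetric H} (hκ : κ.IsKrein) {S : Submodule ℂ H}
    (hS : κ.IsRegular S) : (κ.restrict S).IsKrein := by
  obtain ⟨D⟩ := hκ
  have := D.completeSpace_subspace hS
  have hid : κ.IsAdjoint κ LinearMap.id LinearMap.id := fun _ _ => rfl
  obtain ⟨B, hB⟩ := D.exists_isSignatureMul hid
  -- Here a is the Gram operator of S, ⟨ax, y⟩ = [x, y]. It is injective by nondegeneracy and
  -- surjective by projecting Jv to S, so |a|^{1/2} is bijective and carries the metric of S to the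
  -- one given by the involution u.
  set a := HilbertSchur.blockA B (D.subspace S) with ha
  have hsa : IsSelfAdjoint a := HilbertSchur.isSelfAdjoint_blockA (hB.isSelfAdjoint hid)
  have hform (x y : D.subspace S) : inner ℂ (a x) y =
      κ.form (D.toHilbert.symm (x : D.Hilbert)) (D.toHilbert.symm (y : D.Hilbert)) :=
    hB.inner_blockA x y
  have hmem (x : D.subspace S) : D.toHilbert.symm (x : D.Hilbert) ∈ S := by
    rw [← D.mem_subspace_iff, LinearEquiv.apply_symm_apply]
    exact x.2
  obtain ⟨u, hu⟩ := HilbertSchur.exists_isPolarPart a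
  have hinj (x : D.subspace S) (hx : a x = 0) : x = 0 := by
    have h0 : D.toHilbert.symm (x : D.Hilbert) = 0 := by
      refine D.eq_zero_of_form fun y => ?_
      rw [← κ.symm.eq, ← hS.form_proj₁_right ⟨_, hmem x⟩ y]
      have := hform x ⟨D.toHilbert (hS.proj₁ y), D.mem_subspace_iff.2 (hS.proj₁ y).2⟩
      rw [hx, inner_zero_left, LinearEquiv.symm_apply_apply] at this
      rw [← this, map_zero]
    rw [LinearEquiv.map_eq_zero_iff] at h0
    exact Subtype.ext h0
  have hsurj (v : D.subspace S) : ∃ x, a x = v := by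
    refine ⟨⟨D.toHilbert (hS.proj₁ (D.signature (D.toHilbert.symm (v : D.Hilbert)))),
      D.mem_subspace_iff.2 (Subtype.prop _)⟩, ?_⟩
    refine ext_inner_right ℂ fun y => ?_
    rw [hform, LinearEquiv.symm_apply_apply, hS.form_proj₁_left _ ⟨_, hmem y⟩, ← D.inner_toHilbert,
      LinearEquiv.apply_symm_apply, LinearEquiv.apply_symm_apply]
    rfl
  let r := HilbertSchur.sqrtAbs a
  have hr : Function.Bijective r := by
    constructor
    · refine (injective_iff_map_eq_zero r).2 fun x hx => hinj x ?_
      rwa [← HilbertSchur.sqrtAbs_apply_eq_zero_iff]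
    · intro v
      obtain ⟨x, hx⟩ := hsurj v
      exact ⟨u (r x), by rw [← hx]; exact hu.sqrtAbs_apply_sqrtAbs hsa x⟩
  let e₀ : S ≃ₗ[ℂ] D.subspace S := D.toHilbert.submoduleMap S
  let e : S ≃ₗ[ℂ] D.subspace S :=
    e₀.trans (LinearEquiv.ofBijective (r : D.subspace S →ₗ[ℂ] D.subspace S) hr)
  have he (x : S) : e x = r (e₀ x) := rfl
  have he₀ (x : S) : D.toHilbert.symm (e₀ x : D.Hilbert) = x := rfl
  refine isKrein_of_involution e u (hu.inner_apply_left hsa) (fun x => ?_) fun x y => ?_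
  · obtain ⟨x, rfl⟩ := hr.2 x
    exact hu.apply_apply_sqrtAbs hsa x
  · change κ.form x y = _
    rw [he, he, ← HilbertSchur.inner_sqrtAbs_left, hu.sqrtAbs_apply_sqrtAbs hsa, hform, he₀, he₀]

/-! ### The Krein space 𝒦 and the range of the factor. -/

namespace PolarFactorization

variable {κ : IndefiniteMetric H} {W : H →ₗ[ℂ] H} (F : κ.PolarFactorization W)

theorem U_mem_space (v : F.decomp.Hilbert) : F.U v ∈ F.space := by
  rw [mem_space_iff]
  intro z hz
  refine (F.isPolarPart.inner_apply_left F.isSelfAdjoint_JW z v).symm.trans ?_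
  rw [(F.isPolarPart.apply_eq_zero_iff z).2 ((F.ker_facts z).1.1 hz)]
  exact inner_zero_left _

theorem U_U (v : F.decomp.Hilbert) (hv : v ∈ F.space) : F.U (F.U v) = v := by
  refine closure_minimal (t := {v | F.U (F.U v) = v}) ?_
    (isClosed_eq (by fun_prop) (by fun_prop)) hv
  rintro _ ⟨w, rfl⟩
  change F.U (F.U (CFC.abs F.JW w)) = CFC.abs F.JW w
  rw [← HilbertSchur.sqrtAbs_sqrtAbs, F.isPolarPart.apply_apply_sqrtAbs F.isSelfAdjoint_JW]

instance : CompleteSpace F.space := (Submodule.isClosed_topologicalClosure _).completeSpace_coe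

theorem metric_form (x y : F.space) : F.metric.form x y = inner ℂ (F.U x) (y : F.decomp.Hilbert) :=
  rfl

/-- `𝒦` is a Krein space. -/
theorem isKrein_metric : F.metric.IsKrein :=
  isKrein_of_involution (LinearEquiv.refl ℂ F.space)
    ((F.U ∘L F.space.subtypeL).codRestrict F.space fun v => F.U_mem_space v)
    (fun x y => F.inner_U_symm x y) (fun x => Subtype.ext (F.U_U x x.2)) fun _ _ => rfl

theorem form_op (k : F.space) (y : H) : κ.form (F.op k) y =
    inner ℂ (HilbertSchur.sqrtAbs F.JW k) (F.decomp.toHilbert y) := by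
  have := F.decomp.inner_toHilbert (F.decomp.toHilbert.symm (HilbertSchur.sqrtAbs F.JW k)) y
  rw [LinearEquiv.apply_symm_apply] at this
  exact this.symm

/-- Restricting |JW|^{1/2} to 𝒦 loses nothing from its range, because it vanishes on 𝒦ᗮ. -/
theorem mem_range_op_iff (x : H) : x ∈ LinearMap.range F.op ↔
    F.decomp.toHilbert (F.decomp.signature x) ∈ LinearMap.range
      (HilbertSchur.sqrtAbs F.JW : F.decomp.Hilbert →ₗ[ℂ] F.decomp.Hilbert) := by
  constructor
  · rintro ⟨k, rfl⟩
    refine ⟨k, ?_⟩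
    simp only [op, LinearMap.comp_apply, F.decomp.signature_signature]
    simp
  · rintro ⟨v, hv⟩
    refine ⟨F.space.orthogonalProjectionOnto v, ?_⟩
    have h0 : HilbertSchur.sqrtAbs F.JW (F.space.orthogonalProjectionOnto v : F.decomp.Hilbert) =
        HilbertSchur.sqrtAbs F.JW v := by
      rw [eq_comm, ← sub_eq_zero, ← map_sub, HilbertSchur.sqrtAbs_apply_eq_zero_iff,
        ← HilbertSchur.abs_apply_eq_zero_iff, ← inner_self_eq_zero (𝕜 := ℂ)]
      refine (HilbertSchur.inner_abs_left F.JW _ _).symm.trans ?_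
      have := F.space.sub_starProjection_mem_orthogonal v
      exact this _ (subset_closure ⟨_, rfl⟩)
    refine F.decomp.ext_form fun y => ?_
    rw [form_op, h0]
    refine (congrArg (inner ℂ · _) hv).trans ?_
    rw [F.decomp.inner_toHilbert, F.decomp.signature_signature]

end PolarFactorization

end IndefiniteMetric

/-! ### The Hilbert space Schur complement through whole rows. -/

namespace HilbertSchur

variable {E : Type*} [NormedAddCommGroup E] [InnerProductSpace ℂ E] [CompleteSpace E]
  {B : E →L[ℂ] E} {S : Submodule ℂ E} [CompleteSpace S]

omit [CompleteSpace E] in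
theorem orthogonalProjectionOnto_apply_add (s : S) (m : Sᗮ) :
    S.orthogonalProjectionOnto (B (s + m)) = blockA B S s + blockB B S m := by
  simp [blockA, blockB]

variable {f : Sᗮ →L[ℂ] S} {u : S →L[ℂ] S} (hB : IsSelfAdjoint B)
  (hf : blockB B S = sqrtAbs (blockA B S) ∘L f) (hu : IsPolarPart (blockA B S) u)

include hB hf hu

/-- The solution f for b extends to one for the whole row, because |a|^{1/2} u |a|^{1/2} = a. -/
theorem sqrtAbs_blockA_apply (s : S) (m : Sᗮ) :
    sqrtAbs (blockA B S) (f m + u (sqrtAbs (blockA B S) s)) =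
      S.orthogonalProjectionOnto (B (s + m)) := by
  rw [orthogonalProjectionOnto_apply_add, map_add,
    hu.sqrtAbs_apply_sqrtAbs (isSelfAdjoint_blockA hB), hf, add_comm]
  rfl

/-- The form of the Schur complement, in terms of a factorization of the whole row of `B`. -/
theorem inner_schurComplement (s s' : S) (m m' : Sᗮ) :
    inner ℂ ((Sᗮ.subtypeL ∘L (blockC B S - ContinuousLinearMap.adjoint f ∘L u ∘L f) ∘L
      Sᗮ.orthogonalProjectionOnto) ((s : E) + m)) ((s' : E) + m') =
    inner ℂ (B (s + m)) ((s' : E) + m') -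
      inner ℂ (u (f m + u (sqrtAbs (blockA B S) s))) (f m' + u (sqrtAbs (blockA B S) s')) := by
  have ha := isSelfAdjoint_blockA (S := S) hB
  have hs : ∀ x y, inner ℂ (B x) y = inner ℂ x (B y) :=
    ContinuousLinearMap.isSelfAdjoint_iff_isSymmetric.1 hB
  have hb (x : Sᗮ) : sqrtAbs (blockA B S) (f x) = blockB B S x := by rw [hf]; rfl
  have h0 (x : Sᗮ) (y : S) : inner ℂ (x : E) (y : E) = 0 :=
    Submodule.inner_left_of_mem_orthogonal y.2 x.2
  have hp : Sᗮ.orthogonalProjectionOnto ((s : E) + m) = m := by simp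
  -- The terms that involve s or s' cancel between the two forms, leaving ⟨Bm, m'⟩ - ⟨ufm, fm'⟩.
  have e1 : inner ℂ (u (f m)) (u (sqrtAbs (blockA B S) s')) = inner ℂ (B m) (s' : E) := by
    rw [hu.inner_apply_left ha, hu.apply_apply_sqrtAbs ha, ← inner_sqrtAbs_left, hb,
      inner_blockB_left]
  have e2 : inner ℂ (sqrtAbs (blockA B S) s) (f m') = inner ℂ (B s) (m' : E) := by
    rw [inner_sqrtAbs_left, hb, ← inner_conj_symm, inner_blockB_left, inner_conj_symm, hs]
  have e3 : inner ℂ (sqrtAbs (blockA B S) s) (u (sqrtAbs (blockA B S) s')) =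
      inner ℂ (B s) (s' : E) := by
    rw [← hu.inner_apply_left ha, ← inner_sqrtAbs_left, hu.sqrtAbs_apply_sqrtAbs ha,
      inner_blockA_left]
  have e4 : inner ℂ ((Sᗮ.subtypeL ∘L (blockC B S - ContinuousLinearMap.adjoint f ∘L u ∘L f) ∘L
      Sᗮ.orthogonalProjectionOnto) ((s : E) + m)) ((s' : E) + m') =
      inner ℂ (B m) (m' : E) - inner ℂ (u (f m)) (f m') := by
    simp only [ContinuousLinearMap.comp_apply, hp, Submodule.subtypeL_apply, inner_add_right, h0,
      zero_add]
    rw [← Submodule.coe_inner, sub_apply, inner_sub_left, inner_blockC_left]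
    simp only [ContinuousLinearMap.comp_apply, ContinuousLinearMap.adjoint_inner_left]
  rw [e4, map_add, map_add, hu.apply_apply_sqrtAbs ha]
  simp only [inner_add_left, inner_add_right, e1, e2, e3]
  ring

omit hf hu in
/-- Weak complementability, in terms of the whole row of `B`. -/
theorem isWeaklyComplementable_iff : IsWeaklyComplementable B S ↔
    ∀ x, S.orthogonalProjectionOnto (B x) ∈
      LinearMap.range (sqrtAbs (blockA B S) : S →ₗ[ℂ] S) := by
  constructor
  · intro h x
    obtain ⟨u, hu⟩ := exists_isPolarPart (blockA B S)
    obtain ⟨p, hp, q, hq, rfl⟩ := S.exists_add_mem_mem_orthogonal x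
    have := orthogonalProjectionOnto_apply_add (B := B) (⟨p, hp⟩ : S) ⟨q, hq⟩
    rw [this]
    refine Submodule.add_mem _ ⟨u (sqrtAbs (blockA B S) ⟨p, hp⟩), ?_⟩ (h ⟨_, rfl⟩)
    exact hu.sqrtAbs_apply_sqrtAbs (isSelfAdjoint_blockA hB) _
  · rintro h _ ⟨x, rfl⟩
    exact h x

end HilbertSchur

/-! ### Comparison of the Krein and Hilbert space descriptions. -/

namespace IndefiniteMetric

variable {H H' : Type*} [AddCommGroup H] [Module ℂ H] [AddCommGroup H'] [Module ℂ H']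
  {κ : IndefiniteMetric H} {κ' : IndefiniteMetric H'}

/-- A weakly bounded operator between Krein spaces is bounded and has an adjoint. -/
theorem isBoundedOperator_and_exists_isAdjoint (D : κ.FundamentalDecomposition)
    (D' : κ'.FundamentalDecomposition) (A : H →ₗ[ℂ] H') (s : Set H')
    (hs : ∀ x, (∀ y ∈ s, κ'.form y x = 0) → x = 0)
    (hA : ∀ y ∈ s, ∃ z, ∀ x, κ'.form y (A x) = κ.form z x) :
    κ.IsBoundedOperator κ' A ∧ ∃ A', κ.IsAdjoint κ' A A' := by
  have hc := D'.continuous_toHilbert_comp (A ∘ₗ (D.toHilbert.symm : D.Hilbert →ₗ[ℂ] H)) s hs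
    fun y hy => by
      obtain ⟨z, hz⟩ := hA y hy
      exact (D.continuous_form z).congr fun x => (hz _).symm
  let L : D.Hilbert →L[ℂ] D'.Hilbert := ⟨_, hc⟩
  have hL (x : H) : L (D.toHilbert x) = D'.toHilbert (A x) := rfl
  refine ⟨⟨D, D', ‖L‖, fun x => ?_⟩, ?_⟩
  · rw [← hL]
    exact L.le_opNorm _
  -- The Krein adjoint is J L* J', with L* the Hilbert space adjoint.
  · refine ⟨D.signature ∘ₗ (D.toHilbert.symm : D.Hilbert →ₗ[ℂ] H) ∘ₗ
      (ContinuousLinearMap.adjoint L : D'.Hilbert →ₗ[ℂ] D.Hilbert) ∘ₗ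
      (D'.toHilbert : H' →ₗ[ℂ] D'.Hilbert) ∘ₗ D'.signature, fun x y => ?_⟩
    have h1 : κ'.form (A x) y = inner ℂ (L (D.toHilbert x)) (D'.toHilbert (D'.signature y)) := by
      rw [hL, D'.inner_toHilbert, ← D'.form_signature_right, D'.signature_signature]
    have h2 := ContinuousLinearMap.adjoint_inner_right L (D.toHilbert x)
      (D'.toHilbert (D'.signature y))
    refine h1.trans (h2.symm.trans ?_)
    simp only [LinearMap.comp_apply]
    rw [D.form_signature_right, ← D.inner_toHilbert]
    rfl

variable {S : Submodule ℂ H} (hS : κ.IsRegular S)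

/-- The identity of a regular subspace is an isomorphism between any two of its Hilbert space
structures. -/
theorem FundamentalDecomposition.exists_subspace_equiv (D : κ.FundamentalDecomposition)
    [CompleteSpace (D.subspace S)] (D' : (κ.restrict S).FundamentalDecomposition) :
    ∃ T : D.subspace S ≃L[ℂ] D'.Hilbert,
      ∀ x, (D'.toHilbert.symm (T x) : H) = D.toHilbert.symm (x : D.Hilbert) := by
  let e : D.subspace S ≃ₗ[ℂ] S := (D.toHilbert.submoduleMap S).symm
  have he (x : D.subspace S) : (e x : H) = D.toHilbert.symm (x : D.Hilbert) := rfl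
  have hc := D'.continuous_toHilbert_comp (e : D.subspace S →ₗ[ℂ] S) Set.univ
    (fun x hx => D'.eq_zero_of_form fun y => hx y trivial) fun y _ =>
      ((D.continuous_form y).comp continuous_subtype_val).congr fun x => rfl
  exact ⟨(e.trans D'.toHilbert).toContinuousLinearEquivOfContinuous hc, fun x => rfl⟩

variable {W : H →ₗ[ℂ] H} (F : (κ.restrict S).PolarFactorization (hS.block₁₁ W))
  (D : κ.FundamentalDecomposition) [CompleteSpace (D.subspace S)]
  {B : D.Hilbert →L[ℂ] D.Hilbert} (hB : D.IsSignatureMul W B)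

theorem IsRegular.block_add (x : H) :
    hS.proj₁ (W x) = hS.block₁₁ W (hS.proj₁ x) + hS.block₁₂ W (hS.proj₂ x) := by
  conv_lhs => rw [← hS.proj₁_add_proj₂ x, map_add, map_add]
  rfl

include hB in
theorem FundamentalDecomposition.IsSignatureMul.inner_orthogonalProjectionOnto (x : D.Hilbert)
    (y : D.subspace S) : inner ℂ ((D.subspace S).orthogonalProjectionOnto (B x)) y =
      κ.form (W (D.toHilbert.symm x)) (D.toHilbert.symm (y : D.Hilbert)) := by
  rw [← hB.inner_left]
  exact Submodule.inner_orthogonalProjectionOnto_eq_of_mem_right y _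

namespace PolarFactorization

theorem form_op_block (k : F.space) (x : H) (hk : F.op k = hS.proj₁ (W x)) (y : F.decomp.Hilbert) :
    inner ℂ (HilbertSchur.sqrtAbs F.JW k) y = κ.form (W x) (F.decomp.toHilbert.symm y) := by
  have h := F.form_op k (F.decomp.toHilbert.symm y)
  rw [LinearEquiv.apply_symm_apply, hk] at h
  exact h.symm.trans (hS.form_proj₁_left _ _)

include hB in
-- Both sides equal [Wx, y] on S; this is the congruence hypothesis of the Hilbert space lemmas.
theorem inner_blockA_congr (T : D.subspace S ≃L[ℂ] F.decomp.Hilbert)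
    (hT : ∀ x, (F.decomp.toHilbert.symm (T x) : H) = D.toHilbert.symm (x : D.Hilbert))
    (x y : D.subspace S) : inner ℂ (HilbertSchur.blockA B (D.subspace S) x) y =
      inner ℂ (F.JW (T x)) (T y) := by
  rw [hB.inner_blockA, F.isSignatureMul.inner_left, ← hT, ← hT]
  exact (hS.form_proj₁_left _ _).symm

include hB in
-- The two vectors represent the same functional [Wx, ·] on S in two inner products, so range
-- membership transfers along T.
theorem mem_range_sqrtAbs_blockA_iff (x : H) :
    (D.subspace S).orthogonalProjectionOnto (B (D.toHilbert x)) ∈ LinearMap.range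
        (HilbertSchur.sqrtAbs (HilbertSchur.blockA B (D.subspace S)) :
          D.subspace S →ₗ[ℂ] D.subspace S) ↔
      hS.proj₁ (W x) ∈ LinearMap.range F.op := by
  obtain ⟨T, hT⟩ := D.exists_subspace_equiv F.decomp
  rw [F.mem_range_op_iff]
  refine HilbertSchur.mem_range_sqrtAbs_iff_of_congr T (F.inner_blockA_congr hS D hB T hT)
    fun y => ?_
  rw [hB.inner_orthogonalProjectionOnto, ← hT, LinearEquiv.symm_apply_apply]
  have h := F.decomp.inner_toHilbert (F.decomp.signature (hS.proj₁ (W x)))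
    (F.decomp.toHilbert.symm (T y))
  rw [LinearEquiv.apply_symm_apply, F.decomp.signature_signature] at h
  exact (h.trans (hS.form_proj₁_left _ _)).symm

omit [CompleteSpace (D.subspace S)] in
-- Passing to the whole row is harmless because R(w₁₁) ⊆ R(d), by w₁₁ = dd^#.
theorem range_block₁₂_le_iff : LinearMap.range (hS.block₁₂ W) ≤ LinearMap.range F.op ↔
    ∀ x, hS.proj₁ (W x) ∈ LinearMap.range F.op := by
  constructor
  · intro h x
    obtain ⟨d', -, hd'⟩ := F.op_comp_adjoint
    rw [hS.block_add]
    refine Submodule.add_mem _ ?_ (h ⟨_, rfl⟩)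
    exact ⟨_, LinearMap.congr_fun hd' _⟩
  · rintro h _ ⟨x, rfl⟩
    exact h x

include hB in
theorem isWeaklyComplementable_iff (hW : κ.IsAdjoint κ W W) :
    HilbertSchur.IsWeaklyComplementable B (D.subspace S) ↔
      LinearMap.range (hS.block₁₂ W) ≤ LinearMap.range F.op := by
  rw [HilbertSchur.isWeaklyComplementable_iff (hB.isSelfAdjoint hW), F.range_block₁₂_le_iff hS]
  refine ⟨fun h x => (F.mem_range_sqrtAbs_blockA_iff hS D hB x).1 (h _), fun h x => ?_⟩
  obtain ⟨x, rfl⟩ := D.toHilbert.surjective x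
  exact (F.mem_range_sqrtAbs_blockA_iff hS D hB x).2 (h x)

omit [CompleteSpace (D.subspace S)] in
/-- The form of `diag(0, w₂₂ - y^# y)`, in terms of a factorization of the whole row of `W`. -/
theorem form_diagZero (hW : κ.IsAdjoint κ W W) {y : κ.companion S →ₗ[ℂ] F.space}
    {y' : F.space →ₗ[ℂ] κ.companion S} (hy : hS.block₁₂ W = F.op ∘ₗ y)
    (hy' : (κ.restrict (κ.companion S)).IsAdjoint F.metric y y') {d' : S →ₗ[ℂ] F.space}
    (hd' : F.metric.IsAdjoint (κ.restrict S) F.op d') (hd : F.op ∘ₗ d' = hS.block₁₁ W) (x z : H) :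
    κ.form (hS.diagZero (hS.block₂₂ W - y' ∘ₗ y) x) z = κ.form (W x) z -
      F.metric.form (y (hS.proj₂ x) + d' (hS.proj₁ x)) (y (hS.proj₂ z) + d' (hS.proj₁ z)) := by
  set s := hS.proj₁ x
  set m := hS.proj₂ x
  set s' := hS.proj₁ z
  set m' := hS.proj₂ z
  have hx : (s : H) + m = x := hS.proj₁_add_proj₂ x
  have hz : (s' : H) + m' = z := hS.proj₁_add_proj₂ z
  -- By dy = w₁₂ and dd^# = w₁₁, every term with a component in S cancels, as in
  -- `inner_schurComplement`.
  have hop (n : κ.companion S) (t : S) : F.metric.form (y n) (d' t) = κ.form (W n) t := by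
    rw [← hd' (y n) t]
    have : F.op (y n) = hS.proj₁ (W n) := (LinearMap.congr_fun hy n).symm
    rw [this]
    exact hS.form_proj₁_left _ t
  have e1 : F.metric.form (d' s) (y m') = κ.form (W s) m' := by
    rw [← F.metric.symm.eq, hop, κ.symm.eq, hW]
  have e2 : F.metric.form (d' s) (d' s') = κ.form (W s) s' := by
    rw [← hd' (d' s) s']
    have : F.op (d' s) = hS.proj₁ (W s) := LinearMap.congr_fun hd s
    rw [this]
    exact hS.form_proj₁_left _ s'
  have e3 : κ.form (y' (y m)) m' = F.metric.form (y m) (y m') := by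
    rw [← κ.symm.eq, ← F.metric.symm.eq (y m') (y m), hy']
    rfl
  have e4 : κ.form (hS.block₂₂ W m) m' = κ.form (W m) m' := hS.form_proj₂_left _ m'
  have e5 : hS.diagZero (hS.block₂₂ W - y' ∘ₗ y) x = hS.block₂₂ W m - y' (y m) := rfl
  rw [e5, ← hz, ← hx]
  simp only [map_add, map_sub, LinearMap.add_apply, LinearMap.sub_apply,
    IsRegular.form_companion', e1, e2, e3, e4, hop]
  ring

include hB in
-- The right-hand side does not mention `D`, which is why the Schur complement is independent of J.
theorem form_schurComplement (hW : κ.IsAdjoint κ W W)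
    {f : (D.subspace S)ᗮ →L[ℂ] D.subspace S} {u : D.subspace S →L[ℂ] D.subspace S}
    (hf : HilbertSchur.blockB B (D.subspace S) =
      HilbertSchur.sqrtAbs (HilbertSchur.blockA B (D.subspace S)) ∘L f)
    (hu : HilbertSchur.IsPolarPart (HilbertSchur.blockA B (D.subspace S)) u)
    (x z : H) (k k' : F.space) (hk : F.op k = hS.proj₁ (W x)) (hk' : F.op k' = hS.proj₁ (W z)) :
    inner ℂ (((D.subspace S)ᗮ.subtypeL ∘L (HilbertSchur.blockC B (D.subspace S) -
      ContinuousLinearMap.adjoint f ∘L u ∘L f) ∘L (D.subspace S)ᗮ.orthogonalProjectionOnto)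
      (D.toHilbert x)) (D.toHilbert z) = κ.form (W x) z - F.metric.form k k' := by
  obtain ⟨T, hT⟩ := D.exists_subspace_equiv F.decomp
  have hsa := hB.isSelfAdjoint hW
  obtain ⟨s, hs, m, hm, hx⟩ := (D.subspace S).exists_add_mem_mem_orthogonal (D.toHilbert x)
  obtain ⟨s', hs', m', hm', hz⟩ := (D.subspace S).exists_add_mem_mem_orthogonal (D.toHilbert z)
  have h1 := HilbertSchur.inner_schurComplement hsa hf hu ⟨s, hs⟩ ⟨s', hs'⟩ ⟨m, hm⟩ ⟨m', hm'⟩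
  have h2 := HilbertSchur.sqrtAbs_blockA_apply hsa hf hu ⟨s, hs⟩ ⟨m, hm⟩
  have h3 := HilbertSchur.sqrtAbs_blockA_apply hsa hf hu ⟨s', hs'⟩ ⟨m', hm'⟩
  simp only [← hx, ← hz] at h1 h2 h3
  refine h1.trans ?_
  congr 1
  · refine (hB.inner_left _ _).trans ?_
    rw [LinearEquiv.symm_apply_apply, LinearEquiv.symm_apply_apply]
  · rw [F.metric_form]
    refine HilbertSchur.inner_polarPart_congr T (F.inner_blockA_congr hS D hB T hT) hu
      F.isPolarPart (HilbertSchur.isSelfAdjoint_blockA hsa) F.isSelfAdjoint_JW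
      (fun w => ?_) (fun w => ?_)
    · rw [h2]
      refine (hB.inner_orthogonalProjectionOnto D _ w).trans ?_
      rw [LinearEquiv.symm_apply_apply, ← hT]
      exact (F.form_op_block hS k x hk _).symm
    · rw [h3]
      refine (hB.inner_orthogonalProjectionOnto D _ w).trans ?_
      rw [LinearEquiv.symm_apply_apply, ← hT]
      exact (F.form_op_block hS k' z hk' _).symm

end PolarFactorization

end IndefiniteMetric

end

/-! ### Assembly of the theorem. -/

theorem theorem4p11 {H : Type*} [AddCommGroup H] [Module ℂ H]
    (κ : IndefiniteMetric H) (hκ : κ.IsKrein)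
    (W : H →ₗ[ℂ] H) (hW : κ.IsSelfadjointOperator W)
    (S : Submodule ℂ H) (hS : κ.IsRegular S)
    (F : (κ.restrict S).PolarFactorization (hS.block₁₁ W)) :
    (κ.IsWeaklyComplementable W S ↔
      LinearMap.range (hS.block₁₂ W) ≤ LinearMap.range F.op) ∧
    (κ.IsWeaklyComplementable W S →
      ∃ (y : κ.companion S →ₗ[ℂ] F.space) (y' : F.space →ₗ[ℂ] κ.companion S),
        (κ.restrict (κ.companion S)).IsBoundedOperator F.metric y ∧
        hS.block₁₂ W = F.op ∘ₗ y ∧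
        (∀ x : κ.companion S →ₗ[ℂ] F.space, hS.block₁₂ W = F.op ∘ₗ x → x = y) ∧
        (κ.restrict (κ.companion S)).IsAdjoint F.metric y y' ∧
        ∀ (D : κ.FundamentalDecomposition) (T : H →ₗ[ℂ] H),
          D.IsSchurComplement W S T ↔ T = hS.diagZero (hS.block₂₂ W - y' ∘ₗ y)) := by
  have hiff : κ.IsWeaklyComplementable W S ↔
      LinearMap.range (hS.block₁₂ W) ≤ LinearMap.range F.op := by
    constructor
    · rintro ⟨D, B, hc, hB, hw⟩
      exact (F.isWeaklyComplementable_iff hS D hB hW.adjoint).1 hw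
    · intro h
      obtain ⟨D⟩ := hκ
      obtain ⟨B, hB⟩ := D.exists_isSignatureMul hW.adjoint
      have hc := D.completeSpace_subspace hS
      exact ⟨D, B, hc, hB, (F.isWeaklyComplementable_iff hS D hB hW.adjoint).2 h⟩
  refine ⟨hiff, fun hwc => ?_⟩
  have hle := hiff.1 hwc
  obtain ⟨y, hy⟩ : ∃ y : κ.companion S →ₗ[ℂ] F.space, hS.block₁₂ W = F.op ∘ₗ y := by
    let e := LinearEquiv.ofInjective F.op F.op_injective
    refine ⟨e.symm.toLinearMap ∘ₗ (hS.block₁₂ W).codRestrict _ fun x => hle ⟨x, rfl⟩, ?_⟩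
    ext1 x
    exact (congrArg Subtype.val (e.apply_symm_apply ⟨hS.block₁₂ W x, hle ⟨x, rfl⟩⟩)).symm
  obtain ⟨d', hd', hd⟩ := F.op_comp_adjoint
  obtain ⟨D₀⟩ := id hκ
  obtain ⟨D₂⟩ := (D₀.isRegular_companion hS).isKrein_restrict hκ
  obtain ⟨DK⟩ := F.isKrein_metric
  -- A vector orthogonal to R(d^#) lies in N(d) = {0}.
  have hsep (k : F.space) (hk : ∀ j ∈ Set.range d', F.metric.form j k = 0) : k = 0 := by
    refine F.op_injective ?_
    rw [map_zero]
    refine F.decomp.eq_zero_of_form fun s => ?_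
    rw [← (κ.restrict S).symm.eq, hd', ← F.metric.symm.eq, starRingEnd_self_apply]
    exact hk _ ⟨s, rfl⟩
  -- On R(d^#) weak continuity of y is explicit: [d^#s, yx] = [s, w₁₂x] = [Ws, x].
  have hweak (k : F.space) (hk : k ∈ Set.range d') : ∃ z : κ.companion S,
      ∀ x, F.metric.form k (y x) = (κ.restrict (κ.companion S)).form z x := by
    obtain ⟨s, rfl⟩ := hk
    refine ⟨hS.proj₂ (W s), fun x => ?_⟩
    have hx : F.op (y x) = hS.proj₁ (W x) := (LinearMap.congr_fun hy x).symm
    have h1 : (κ.restrict S).form (hS.proj₁ (W x)) s = κ.form (W x) s := hS.form_proj₁_left _ s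
    rw [← F.metric.symm.eq, ← hd', hx, h1, κ.symm.eq, ← hW.adjoint]
    exact (hS.form_proj₂_left _ x).symm
  obtain ⟨hyb, y', hy'⟩ := IndefiniteMetric.isBoundedOperator_and_exists_isAdjoint D₂ DK y
    (Set.range d') hsep hweak
  refine ⟨y, y', hyb, hy, fun x hx => ?_, hy', fun D => ?_⟩
  · ext1 z
    refine F.op_injective ?_
    exact (LinearMap.congr_fun hx z).symm.trans (LinearMap.congr_fun hy z)
  · have key (T : H →ₗ[ℂ] H) (hT : D.IsSchurComplement W S T) :
        T = hS.diagZero (hS.block₂₂ W - y' ∘ₗ y) := by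
      obtain ⟨B, T₀, hc, hB, ⟨f, u, hf, hu, rfl⟩, hT⟩ := hT
      ext x
      refine D.ext_form fun z => ?_
      have hk (x : H) : F.op (y (hS.proj₂ x) + d' (hS.proj₁ x)) = hS.proj₁ (W x) := by
        rw [hS.block_add, map_add, add_comm]
        congr 1
        · exact LinearMap.congr_fun hd _
        · exact (LinearMap.congr_fun hy _).symm
      rw [F.form_diagZero hS hW.adjoint hy hy' hd' hd,
        ← F.form_schurComplement hS D hB hW.adjoint hf.eq_comp hu x z _ _ (hk x) (hk z), hT,
        ← D.inner_toHilbert, LinearEquiv.apply_symm_apply]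
    refine fun T => ⟨key T, ?_⟩
    rintro rfl
    -- For the converse it suffices to construct some Schur complement for J; `key` identifies it.
    obtain ⟨B, hB⟩ := D.exists_isSignatureMul hW.adjoint
    have hc := D.completeSpace_subspace hS
    obtain ⟨f, hf⟩ := HilbertSchur.exists_isReducedSolution _ _
      ((F.isWeaklyComplementable_iff hS D hB hW.adjoint).2 hle)
    obtain ⟨u, hu⟩ := HilbertSchur.exists_isPolarPart (HilbertSchur.blockA B (D.subspace S))
    let T₀ := (D.subspace S)ᗮ.subtypeL ∘L (HilbertSchur.blockC B (D.subspace S) -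
      ContinuousLinearMap.adjoint f ∘L u ∘L f) ∘L (D.subspace S)ᗮ.orthogonalProjectionOnto
    let T : H →ₗ[ℂ] H := D.signature ∘ₗ (D.toHilbert.symm : D.Hilbert →ₗ[ℂ] H) ∘ₗ
      (T₀ : D.Hilbert →ₗ[ℂ] D.Hilbert) ∘ₗ (D.toHilbert : H →ₗ[ℂ] D.Hilbert)
    have hT : D.IsSchurComplement W S T :=
      ⟨B, T₀, hc, hB, ⟨f, u, hf, hu, rfl⟩, fun _ => rfl⟩
    rw [← key T hT]
    exact hT
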